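/- Let $p$ be an odd prime, let $K$ be a number field with algebraic closure $\overline K$ and absolute Galois groups $\mathrm{Gal}_F=\mathrm{Gal}(\overline K/F)$ for $K\subseteq F\subseteq\overline K$. Let $L$ be an imaginary quadratic field, $KL$ the compositum of $K$ and $L$ in $\overline K$, and let $\mathcal O=\mathbb Z+f\mathcal O_L$ be an order in $L$ of conductor $f$, with discriminant $d_{\mathcal O}=f^2d_L$. For a finite-dimensional $\mathbb F_p$-representation $M$ of $\mathrm{Gal}_K$ write $M^\vee(1)$ for the first Tate twist of its Pontryagin dual. Let $E/K$ be an elliptic curve and $E[p]$ the $\mathrm{Gal}_K$-module of its $p$-torsion points over $\overline K$. Suppose that (i) $KL\neq K$ and $E$ has complex multiplication by $\mathcal O$ over $KL$, i.e. the ring of endomorphisms of $E$ defined over $KL$ is isomorphic to $\mathcal O$ and all endomorphisms of $E$ over $\overline K$ are defined over $KL$; (ii) $T\subset E[p]$ is a $\mathrm{Gal}_K$-submodule of rank $1$ over $\mathbb F_p$; (iii) $T\not\cong T^\vee(1)$ as $\mathrm{Gal}_K$-modules; (iv) $E[p]$ is a non-trivial extension of $T^\vee(1)$ by $T$, i.e.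 there is an exact sequence $0\to T\to E[p]\to T^\vee(1)\to 0$ of $\mathrm{Gal}_K$-modules, with the inclusion as its first map, which does not split. Then $p$ divides $d_{\mathcal O}$, and $T\cong T^\vee(1)$ as $\mathrm{Gal}_{KL}$-modules. Moreover, if $p\equiv 3\pmod 4$ and $\sqrt{-p}\in K$, then no such curve $E$ exists. -/

import Mathlib

open scoped NumberField WeierstrassCurve.Affine

noncomputable section

/-! ### Galois representations with coefficients in a prime field -/

section Representations

variable {k G V W : Type*} [Field k] [Group G] [AddCommGroup V] [Module k V]
  [AddCommGroup W] [Module k W]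

/-- Two `k`-linear representations of `G` become isomorphic after restriction to the subgroup
`H` of `G`. -/
def IsIsomorphicOn (H : Subgroup G) (ρ : Representation k G V) (σ : Representation k G W) : Prop :=
  Nonempty (Representation.Equiv
    (ρ.comp H.subtype : Representation k H V) (σ.comp H.subtype : Representation k H W))

/-- `V` is a non-trivial extension of `W` by its subrepresentation `T`: there is an exact sequence
`0 → T → V → W → 0` of representations of `G`, with `T → V` the inclusion, which does not split
`G`-equivariantly. -/
def IsNontrivialExtension (ρ : Representation k G V) (T : Subrepresentation ρ)
    (σ : Representation k G W) : Prop :=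
  ∃ π : Representation.IntertwiningMap ρ σ, Function.Surjective π ∧
    (∀ v : V, π v = 0 ↔ v ∈ T) ∧
    ¬ ∃ s : Representation.IntertwiningMap σ ρ, ∀ w : W, π (s w) = w

end Representations

section Cyclotomic

variable {K : Type*} [Field K] [CharZero K] (p : ℕ) [Fact p.Prime]

theorem natCard_rootsOfUnity_algebraicClosure :
    Nat.card (rootsOfUnity p (AlgebraicClosure K)) = p :=
  HasEnoughRootsOfUnity.natCard_rootsOfUnity (AlgebraicClosure K) p

/-- The mod `p` cyclotomic character of the absolute Galois group of `K`: the action on the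
`p`-th roots of unity. -/
def modCyclotomicCharacter : Gal(AlgebraicClosure K/K) →* (ZMod p)ˣ where
  toFun σ := modularCyclotomicCharacter (AlgebraicClosure K)
    (natCard_rootsOfUnity_algebraicClosure (K := K) p) (σ : AlgebraicClosure K ≃+* AlgebraicClosure K)
  map_one' := map_one (modularCyclotomicCharacter (AlgebraicClosure K)
    (natCard_rootsOfUnity_algebraicClosure (K := K) p))
  map_mul' σ τ := map_mul (modularCyclotomicCharacter (AlgebraicClosure K)
    (natCard_rootsOfUnity_algebraicClosure (K := K) p))
      (σ : AlgebraicClosure K ≃+* AlgebraicClosure K) (τ : AlgebraicClosure K ≃+* AlgebraicClosure K)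

variable {p} {V : Type*} [AddCommGroup V] [Module (ZMod p) V]

/-- The first Tate twist `M^∨(1)` of the (Pontryagin) dual of an `𝔽_p`-linear representation `M`
of the absolute Galois group of `K`: the Galois group acts on the dual space `Hom(M, 𝔽_p)`
through the contragredient action multiplied by the cyclotomic character. -/
def dualTwist (ρ : Representation (ZMod p) Gal(AlgebraicClosure K/K) V) :
    Representation (ZMod p) Gal(AlgebraicClosure K/K) (Module.Dual (ZMod p) V) where
  toFun σ := ((modCyclotomicCharacter p σ : (ZMod p)ˣ) : ZMod p) • ρ.dual σ
  map_one' := by rw [map_one, map_one, Units.val_one, one_smul]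
  map_mul' σ τ := by
    rw [map_mul, map_mul, Units.val_mul, smul_mul_smul_comm]

end Cyclotomic

namespace WeierstrassCurve

variable {K : Type*} [Field K] (E : WeierstrassCurve K)

/-- The points of `E` over the algebraic closure of `K`. -/
abbrev GeomPoint : Type _ := (E⁄(AlgebraicClosure K)).Point

open scoped Classical in
/-- The `n`-torsion subgroup `E[n]` of the points of `E` over the algebraic closure. -/
abbrev Torsion (n : ℕ) : AddSubgroup E.GeomPoint := AddSubgroup.torsionBy E.GeomPoint (n : ℤ)

open scoped Classical in
instance (n : ℕ) : Module (ZMod n) (E.Torsion n) := AddSubgroup.torsionBy.zmodModule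

open scoped Classical in
/-- The `Gal_K`-representation `E[n]`, with `σ(x, y) = (σ x, σ y)`. -/
def torsionRep (n : ℕ) :
    Representation (ZMod n) Gal(AlgebraicClosure K/K) (E.Torsion n) where
  toFun σ := AddMonoidHom.toZModLinearMap n
    (((Affine.Point.map (W' := E) σ.toAlgHom).comp (E.Torsion n).subtype).codRestrict (E.Torsion n)
      (fun P => by
        rw [AddSubgroup.torsionBy.nsmul_iff, ← map_nsmul, AddSubgroup.torsionBy.nsmul, map_zero]))
  map_one' := by
    ext P
    rcases P with ⟨_ | _, _⟩ <;> rfl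
  map_mul' σ τ := by
    ext P
    rcases P with ⟨_ | _, _⟩ <;> rfl

variable {E}

open scoped Classical in
/-- An endomorphism `φ` of the group `E(K̄)` is an endomorphism of the elliptic curve `E` defined
over the intermediate field `F` if it is given by rational functions with coefficients in `F`:
either `φ = 0`, or there are polynomials `a`, `b`, `d` over `F` such that
`φ (x, y) = (a(x, y) / d(x, y), b(x, y) / d(x, y))` for all but finitely many points `(x, y)`.
(A rational map from a smooth projective curve extends uniquely to a morphism, and a group
endomorphism which agrees with a morphism off a finite set agrees with it everywhere.) -/
def IsEndDefinedOver (F : IntermediateField K (AlgebraicClosure K))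
    (φ : AddMonoid.End E.GeomPoint) : Prop :=
  φ = 0 ∨ ∃ a b d : MvPolynomial (Fin 2) F,
    {P : E.GeomPoint | ¬ ∃ x y h h', P = .some x y h ∧ MvPolynomial.aeval ![x, y] d ≠ 0 ∧
      φ P = .some (MvPolynomial.aeval ![x, y] a / MvPolynomial.aeval ![x, y] d)
        (MvPolynomial.aeval ![x, y] b / MvPolynomial.aeval ![x, y] d) h'}.Finite

variable (E)

open scoped Classical in
/-- `E` has complex multiplication by the ring `O` over the intermediate field `F`: the ring of
endomorphisms of `E` defined over `F` is isomorphic to `O`, and all endomorphisms of `E` over the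
algebraic closure are already defined over `F`. -/
def HasCMOver (O : Type*) [Ring O] (F : IntermediateField K (AlgebraicClosure K)) : Prop :=
  (∃ ι : O →+* AddMonoid.End E.GeomPoint,
    Function.Injective ι ∧ Set.range ι = {φ | IsEndDefinedOver F φ}) ∧
  ∀ φ : AddMonoid.End E.GeomPoint, IsEndDefinedOver ⊤ φ → IsEndDefinedOver F φ

end WeierstrassCurve

/-! ### Orders -/

section Orders

variable {L : Type*} [Field L] [NumberField L] (O : Subring L)

/-- A subring of `L` is an order if it is finitely generated as an abelian group and spans `L`
over `ℚ`. -/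
def IsOrderIn : Prop := O.toAddSubgroup.FG ∧ Submodule.span ℚ (O : Set L) = ⊤

/-- The conductor of an order in a quadratic field: its index `f` in the maximal order `𝓞 L`
(so that the order equals `ℤ + f 𝓞 L`). -/
def orderConductor : ℕ := O.toAddSubgroup.relIndex (algebraMap (𝓞 L) L).range.toAddSubgroup

/-- The discriminant `f² d_L` of an order of conductor `f`. -/
def orderDiscr : ℤ := (orderConductor O : ℤ) ^ 2 * NumberField.discr L

end Orders

/-- The compositum `KL` inside the algebraic closure of `K`, for an embedding `j` of `L`. -/
def compositum (K : Type*) [Field K] {L : Type*} [Field L] (j : L →+* AlgebraicClosure K) :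
    IntermediateField K (AlgebraicClosure K) :=
  IntermediateField.adjoin K (Set.range j)

end

/-! Choose a trace-zero element δ of O with δ² = m a nonzero integer, where p ∣ m forces p ∣ f²d_L,
and let φ be the corresponding endomorphism of E. Galois conjugation can only change φ by a sign
ε(g), and ε(g) = 1 exactly when g fixes δ, that is, when g fixes KL. Since KL ≠ K, both signs occur.

Write a for the character of T and b = χa⁻¹ for that of T^∨(1), with χ the cyclotomic character. On
E[p], φ commutes with Galois up to ε. It preserves T, since otherwise φ(T) would be a stable
complement and split the extension. An element with ε = -1 then forces φ to kill T, so m = φ²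
vanishes mod p. This is the divisibility.

If φ kills all of E[p], then it is divisible by p, because E(K̄) is p-divisible; after finitely many
divisions it is nonzero on E[p]. It then still kills T and has image in T, so it induces a nonzero
map from T^∨(1) to T, equivariant over KL. Hence a = b there.

So a² = χ over KL. Every g² fixes KL, so χ(g) = ±a(g)² for all g. As T and T^∨(1) are not isomorphic
over K, the minus sign occurs. If p ≡ 3 mod 4, this value of χ is a non-square, whereas √-p ∈ K
makes all values of χ squares, by the quadratic Gauss sum.

Matching ε with the action on δ uses the scalar by which φ acts on the invariant differential. In
the coordinates x and η = 2y + a₁x + a₃, φ reads x ↦ X(x), η ↦ B(x)η, and the scalar is the value of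
(X/x)/B at infinity; see `HasRep.exists_hasLim_of_sq` and `exists_sqrt_of_sq`. The linear algebra is
in `IsNontrivialExtension.scalar_eq_of_apply_ne_zero`, and the pieces meet in
`galois_structure_of_sq_eq_int`. -/

noncomputable section

open Polynomial Filter

/-! ### Rational functions of one variable and their values at infinity -/

section RationalFunctions

variable {k : Type*} [Field k]

/-- A function on a field agrees with a quotient of polynomials off a finite set. -/
def IsRationalFun (r : k → k) : Prop :=
  ∃ p q : k[X], q ≠ 0 ∧ ∀ᶠ x in cofinite, r x = p.eval x / q.eval x

/-- A function agrees off a finite set with a quotient of polynomials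
whose value at infinity is `c`. -/
def HasLimAtInfty (r : k → k) (c : k) : Prop :=
  ∃ (n : ℕ) (p q : k[X]), p.natDegree ≤ n ∧ q.natDegree ≤ n ∧ q.coeff n ≠ 0 ∧
    p.coeff n = c * q.coeff n ∧ ∀ᶠ x in cofinite, r x = p.eval x / q.eval x

theorem Polynomial.eventually_eval_ne_zero {p : k[X]} (hp : p ≠ 0) :
    ∀ᶠ x in cofinite, p.eval x ≠ 0 := by
  have : {x | ¬ p.eval x ≠ 0} = {x | p.IsRoot x} := by ext; simp
  rw [eventually_cofinite, this]
  exact finite_setOfPred_isRoot hp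

theorem Polynomial.eq_of_eventually_eval_eq [Infinite k] {p q : k[X]}
    (h : ∀ᶠ x in cofinite, p.eval x = q.eval x) : p = q := by
  apply eq_of_infinite_eval_eq
  intro hf
  have h2 := h.and (hf.compl_mem_cofinite)
  obtain ⟨x, hx, hx'⟩ := h2.exists
  exact hx' hx

namespace HasLimAtInfty

variable {r s : k → k} {c d : k}

theorem congr' (h : HasLimAtInfty r c) (hrs : ∀ᶠ x in cofinite, s x = r x) :
    HasLimAtInfty s c := by
  obtain ⟨n, p, q, hp, hq, hn, hc, h⟩ := h
  refine ⟨n, p, q, hp, hq, hn, hc, ?_⟩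
  filter_upwards [h, hrs] with x h1 h2 using h2.trans h1

theorem const (c : k) : HasLimAtInfty (fun _ => c) c :=
  ⟨0, C c, 1, by simp, by simp, by simp, by simp, by simp⟩

theorem inv_id : HasLimAtInfty (fun x : k => x⁻¹) 0 :=
  ⟨1, 1, X, by simp, by simp, by simp, by simp [coeff_one], by simp⟩

theorem add (hr : HasLimAtInfty r c) (hs : HasLimAtInfty s d) :
    HasLimAtInfty (fun x => r x + s x) (c + d) := by
  obtain ⟨n, p, q, hp, hq, hn, hc, h⟩ := hr
  obtain ⟨n', p', q', hp', hq', hn', hc', h'⟩ := hs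
  have e1 : q ≠ 0 := fun h0 => hn (by simp [h0])
  have e2 : q' ≠ 0 := fun h0 => hn' (by simp [h0])
  refine ⟨n + n', p * q' + q * p', q * q', ?_, ?_, ?_, ?_, ?_⟩
  · exact natDegree_add_le_of_degree_le (natDegree_mul_le_of_le hp hq')
      (natDegree_mul_le_of_le hq hp')
  · exact natDegree_mul_le_of_le hq hq'
  · rw [coeff_mul_add_eq_of_natDegree_le hq hq']
    exact mul_ne_zero hn hn'
  · rw [coeff_add, coeff_mul_add_eq_of_natDegree_le hq hq', coeff_mul_add_eq_of_natDegree_le hp hq',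
      coeff_mul_add_eq_of_natDegree_le hq hp', hc, hc']
    ring
  · filter_upwards [h, h', eventually_eval_ne_zero e1, eventually_eval_ne_zero e2]
      with x h1 h2 h3 h4
    rw [h1, h2, eval_add, eval_mul, eval_mul, eval_mul, div_add_div _ _ h3 h4]

theorem mul (hr : HasLimAtInfty r c) (hs : HasLimAtInfty s d) :
    HasLimAtInfty (fun x => r x * s x) (c * d) := by
  obtain ⟨n, p, q, hp, hq, hn, hc, h⟩ := hr
  obtain ⟨n', p', q', hp', hq', hn', hc', h'⟩ := hs
  refine ⟨n + n', p * p', q * q', ?_, ?_, ?_, ?_, ?_⟩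
  · exact natDegree_mul_le_of_le hp hp'
  · exact natDegree_mul_le_of_le hq hq'
  · rw [coeff_mul_add_eq_of_natDegree_le hq hq']
    exact mul_ne_zero hn hn'
  · rw [coeff_mul_add_eq_of_natDegree_le hq hq', coeff_mul_add_eq_of_natDegree_le hp hp', hc, hc']
    ring
  · filter_upwards [h, h'] with x h1 h2
    rw [h1, h2, eval_mul, eval_mul, div_mul_div_comm]

theorem neg (hr : HasLimAtInfty r c) : HasLimAtInfty (fun x => - r x) (-c) := by
  simpa using (const (-1 : k)).mul hr

theorem sub (hr : HasLimAtInfty r c) (hs : HasLimAtInfty s d) :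
    HasLimAtInfty (fun x => r x - s x) (c - d) := by
  simpa [sub_eq_add_neg] using hr.add hs.neg

theorem pow (hr : HasLimAtInfty r c) (n : ℕ) : HasLimAtInfty (fun x => r x ^ n) (c ^ n) := by
  induction n with
  | zero => simpa using const (1 : k)
  | succ n ih => simpa [pow_succ] using ih.mul hr

theorem inv (hr : HasLimAtInfty r c) (hc0 : c ≠ 0) :
    HasLimAtInfty (fun x => (r x)⁻¹) c⁻¹ := by
  obtain ⟨n, p, q, hp, hq, hn, hc, h⟩ := hr
  refine ⟨n, q, p, hq, hp, ?_, ?_, ?_⟩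
  · rw [hc]; exact mul_ne_zero hc0 hn
  · rw [hc, inv_mul_cancel_left₀ hc0]
  · filter_upwards [h] with x h1
    rw [h1, inv_div]

theorem div (hr : HasLimAtInfty r c) (hs : HasLimAtInfty s d) (hd : d ≠ 0) :
    HasLimAtInfty (fun x => r x / s x) (c / d) := by
  simpa [div_eq_mul_inv] using hr.mul (hs.inv hd)

theorem eventually_ne_zero (hr : HasLimAtInfty r c) (hc0 : c ≠ 0) :
    ∀ᶠ x in cofinite, r x ≠ 0 := by
  obtain ⟨n, p, q, hp, hq, hn, hc, h⟩ := hr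
  have e1 : q ≠ 0 := fun h0 => hn (by simp [h0])
  have e2 : p ≠ 0 := fun h0 => mul_ne_zero hc0 hn (by rw [← hc, h0, coeff_zero])
  filter_upwards [h, eventually_eval_ne_zero e1, eventually_eval_ne_zero e2] with x h1 h2 h3
  rw [h1]
  exact div_ne_zero h3 h2

theorem polynomial_eval (hr : HasLimAtInfty r c) (P : k[X]) :
    HasLimAtInfty (fun x => P.eval (r x)) (P.eval c) := by
  induction P using Polynomial.induction_on' with
  | add p q hp hq => simpa using hp.add hq
  | monomial n a => simpa using (const a).mul (hr.pow n)

theorem unique [Infinite k] (hr : HasLimAtInfty r c) (hr' : HasLimAtInfty r d) : c = d := by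
  by_contra hcd
  have h := (hr.sub hr').eventually_ne_zero (sub_ne_zero.2 hcd)
  obtain ⟨x, hx⟩ := h.exists
  simp at hx

theorem eventually_ne [Infinite k] (hr : HasLimAtInfty r c) (hcd : c ≠ d) :
    ∀ᶠ x in cofinite, r x ≠ d := by
  filter_upwards [(hr.sub (const d)).eventually_ne_zero (sub_ne_zero.2 hcd)] with x hx
  exact sub_ne_zero.1 hx

theorem zero_of_pow [Infinite k] {n : ℕ} (h : HasLimAtInfty (fun x : k => x ^ n) c) :
    n = 0 := by
  by_contra hn
  have h2 := h.mul ((inv_id (k := k)).pow n)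
  rw [zero_pow hn, mul_zero] at h2
  have h3 : HasLimAtInfty (fun x : k => x ^ n * x⁻¹ ^ n) 1 := by
    refine (const 1).congr' ?_
    filter_upwards [(Set.finite_singleton (0 : k)).compl_mem_cofinite] with x hx
    rw [← mul_pow, mul_inv_cancel₀ hx, one_pow]
  exact one_ne_zero (h3.unique h2)

/-- The function `s` has a pole at infinity. -/
theorem tendsto_cofinite [Infinite k] (h : HasLimAtInfty (fun x => (s x)⁻¹) 0)
    (h0 : ∀ᶠ x in cofinite, s x ≠ 0) : Tendsto s cofinite cofinite := by
  refine Tendsto.cofinite_of_finite_preimage_singleton fun b => ?_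
  by_cases hb : b = 0
  · subst hb
    exact (eventually_cofinite.1 h0).subset fun x hx => by simpa using hx
  · have := h.eventually_ne (d := b⁻¹) (by simpa using (Ne.symm (inv_ne_zero hb)))
    rw [eventually_cofinite] at this
    refine this.subset fun x hx => ?_
    simp only [Set.mem_preimage, Set.mem_singleton_iff] at hx
    simp [hx]

/-- Substituting a function with a pole keeps the value at infinity. Nonvanishing of s is a separate
hypothesis because 0⁻¹ = 0 would let s = 0 pass for a pole. -/
theorem comp [Infinite k] (hr : HasLimAtInfty r c) (h : HasLimAtInfty (fun x => (s x)⁻¹) 0)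
    (h0 : ∀ᶠ x in cofinite, s x ≠ 0) : HasLimAtInfty (fun x => r (s x)) c := by
  have ht := tendsto_cofinite h h0
  obtain ⟨n, p, q, hp, hq, hn, hc, hr⟩ := hr
  -- P(s)/sⁿ is the reversed polynomial evaluated at s⁻¹, and s⁻¹ has value 0 at infinity.
  have key : ∀ P : k[X], P.natDegree ≤ n → HasLimAtInfty (fun x => P.eval (s x) * ((s x)⁻¹) ^ n)
      (P.coeff n) := by
    intro P hP
    have h1 := h.polynomial_eval (P.reflect n)
    rw [← coeff_zero_eq_eval_zero, coeff_reflect, revAt_le (Nat.zero_le n), Nat.sub_zero] at h1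
    refine h1.congr' ?_
    filter_upwards [h0] with x hx
    let _ := invertibleOfNonzero hx
    have := eval₂_reflect_mul_pow (RingHom.id k) (s x) n P hP
    rw [invOf_eq_inv] at this
    simp only [eval₂_id] at this
    rw [← this, mul_assoc, ← mul_pow, mul_inv_cancel₀ hx, one_pow, mul_one]
  have h2 := (key p hp).div (key q hq) hn
  rw [hc, mul_div_assoc, div_self hn, mul_one] at h2
  refine h2.congr' ?_
  filter_upwards [ht.eventually hr, h0] with x hx hx0
  rw [hx, mul_div_mul_right _ _ (pow_ne_zero _ (inv_ne_zero hx0))]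

end HasLimAtInfty

/-- Comparing the degrees of numerator and denominator leaves either a finite value or a pole of
some order n with leading coefficient c. -/
theorem IsRationalFun.exists_hasLimAtInfty {r : k → k} (h : IsRationalFun r) :
    (∃ c, HasLimAtInfty r c) ∨
      ∃ (n : ℕ) (c : k), n ≠ 0 ∧ c ≠ 0 ∧ HasLimAtInfty (fun x => r x / x ^ n) c := by
  obtain ⟨p, q, hq, h⟩ := h
  rcases le_or_gt p.natDegree q.natDegree with hd | hd
  · left
    refine ⟨p.coeff q.natDegree / q.leadingCoeff, q.natDegree, p, q, hd, le_rfl, ?_, ?_, h⟩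
    · simpa using hq
    · rw [coeff_natDegree, div_mul_cancel₀]
      simpa using hq
  · right
    have hp : p ≠ 0 := by rintro rfl; simp at hd
    have e : (q * X ^ (p.natDegree - q.natDegree)).coeff p.natDegree = q.leadingCoeff := by
      have h2 : p.natDegree = q.natDegree + (p.natDegree - q.natDegree) := by omega
      conv_lhs => rw [h2]
      rw [show q.natDegree + (p.natDegree - q.natDegree) - q.natDegree =
        p.natDegree - q.natDegree by omega, coeff_mul_X_pow, coeff_natDegree]
    refine ⟨p.natDegree - q.natDegree, p.leadingCoeff / q.leadingCoeff, by omega, ?_,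
      p.natDegree, p, q * X ^ (p.natDegree - q.natDegree), le_rfl, ?_, ?_, ?_, ?_⟩
    · exact div_ne_zero (by simpa using hp) (by simpa using hq)
    · refine natDegree_mul_le.trans ?_
      rw [natDegree_X_pow]; omega
    · rw [e]; simpa using hq
    · rw [e, coeff_natDegree, div_mul_cancel₀]; simpa using hq
    · filter_upwards [h] with x hx
      rw [hx, eval_mul, eval_pow, eval_X, div_div]

end RationalFunctions

/-! ### The group law in the coordinates x and η -/

namespace WeierstrassCurve.Affine.Point

variable {k : Type*} [Field k] {W : WeierstrassCurve.Affine k}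

/-- The `x`-coordinate of a point, with value `0` at the point at infinity. -/
def xCoord : W.Point → k
  | .zero => 0
  | .some x _ _ => x

/-- The function `2y + a₁x + a₃`, with value `0` at the point at infinity. -/
def eta : W.Point → k
  | .zero => 0
  | .some x y _ => 2 * y + W.a₁ * x + W.a₃

@[simp] theorem xCoord_some {x y : k} (h : W.Nonsingular x y) : xCoord (.some x y h) = x := rfl

@[simp] theorem eta_some {x y : k} (h : W.Nonsingular x y) :
    eta (.some x y h) = 2 * y + W.a₁ * x + W.a₃ := rfl

theorem eval_Ψ₂Sq (x : k) :
    W.Ψ₂Sq.eval x = 4 * x ^ 3 + W.b₂ * x ^ 2 + 2 * W.b₄ * x + W.b₆ := by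
  simp [WeierstrassCurve.Ψ₂Sq]

theorem eta_sq {P : W.Point} (hP : P ≠ 0) : eta P ^ 2 = W.Ψ₂Sq.eval (xCoord P) := by
  rcases P with _ | ⟨x, y, h⟩
  · exact (hP rfl).elim
  · have := (W.equation_iff x y).1 h.1
    rw [eval_Ψ₂Sq, xCoord_some, eta_some, b₂, b₄, b₆]
    linear_combination 4 * this

@[simp] theorem xCoord_neg (P : W.Point) : xCoord (-P) = xCoord P := by
  rcases P with _ | ⟨x, y, h⟩ <;> rfl

@[simp] theorem eta_neg (P : W.Point) : eta (-P) = - eta P := by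
  rcases P with _ | ⟨x, y, h⟩
  · exact (_root_.neg_zero (G := k)).symm
  · rw [neg_some, eta_some, eta_some, negY]
    ring

theorem eq_or_eq_neg_of_xCoord_eq {P Q : W.Point} (hP : P ≠ 0) (hQ : Q ≠ 0)
    (h : xCoord P = xCoord Q) : P = Q ∨ P = -Q := by
  rcases P with _ | ⟨x, y, h1⟩
  · exact (hP rfl).elim
  rcases Q with _ | ⟨x', y', h2⟩
  · exact (hQ rfl).elim
  exact X_eq_iff.1 h

theorem finite_xCoord_preimage (a : k) : {P : W.Point | xCoord P = a}.Finite := by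
  by_cases h : ∃ Q : W.Point, Q ≠ 0 ∧ xCoord Q = a
  · obtain ⟨Q, hQ, rfl⟩ := h
    refine (Set.toFinite {0, Q, -Q}).subset fun P hP => ?_
    by_cases hP0 : P = 0
    · simp [hP0]
    · rcases eq_or_eq_neg_of_xCoord_eq hP0 hQ hP with h | h <;> simp [h]
  · refine (Set.finite_singleton 0).subset fun P hP => ?_
    by_contra hP0
    exact h ⟨P, hP0, hP⟩

theorem tendsto_xCoord : Tendsto (xCoord : W.Point → k) cofinite cofinite :=
  Tendsto.cofinite_of_finite_preimage_singleton fun b => finite_xCoord_preimage b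

theorem eventually_ne_zero : ∀ᶠ P : W.Point in cofinite, P ≠ 0 :=
  (Set.finite_singleton 0).compl_mem_cofinite

section AddFormulas

variable [DecidableEq k] [CharZero k]

/-- A chord of slope λ in (x, y) has slope 2λ + a₁ in (x, η), and completing the square leaves only
b₂ in the formula. -/
theorem add_formula {P Q : W.Point} (hP : P ≠ 0) (hQ : Q ≠ 0) (h : xCoord P ≠ xCoord Q) :
    P + Q ≠ 0 ∧
      xCoord (P + Q) = ((eta P - eta Q) / (xCoord P - xCoord Q)) ^ 2 / 4 - W.b₂ / 4 -
        xCoord P - xCoord Q ∧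
      eta (P + Q) = -((eta P - eta Q) / (xCoord P - xCoord Q) * (xCoord (P + Q) - xCoord P) +
        eta P) := by
  rcases P with _ | ⟨x, y, h1⟩
  · exact (hP rfl).elim
  rcases Q with _ | ⟨x', y', h2⟩
  · exact (hQ rfl).elim
  simp only [xCoord_some] at h
  have h4 : x - x' ≠ 0 := sub_ne_zero.2 h
  rw [add_of_X_ne h]
  refine ⟨some_ne_zero _, ?_, ?_⟩
  · simp only [xCoord_some, eta_some, addX, slope_of_X_ne h, b₂]
    field_simp
    ring
  · simp only [xCoord_some, eta_some, addY, negAddY, negY, addX, slope_of_X_ne h]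
    field_simp
    ring

/-- The tangent slope comes from differentiating η² = 4x³ + b₂x² + 2b₄x + b₆. -/
theorem double_formula {P : W.Point} (hP : P ≠ 0) (h : eta P ≠ 0) :
    P + P ≠ 0 ∧
      xCoord (P + P) = ((6 * xCoord P ^ 2 + W.b₂ * xCoord P + W.b₄) / eta P) ^ 2 / 4 - W.b₂ / 4 -
        2 * xCoord P ∧
      eta (P + P) = -((6 * xCoord P ^ 2 + W.b₂ * xCoord P + W.b₄) / eta P *
        (xCoord (P + P) - xCoord P) + eta P) := by
  rcases P with _ | ⟨x, y, h1⟩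
  · exact (hP rfl).elim
  simp only [eta_some] at h
  have hy : y ≠ W.negY x y := by
    intro hy
    rw [negY] at hy
    exact h (by linear_combination hy)
  have h5 : y - W.negY x y ≠ 0 := sub_ne_zero.2 hy
  have h6 : y - W.negY x y = 2 * y + W.a₁ * x + W.a₃ := by rw [negY]; ring
  rw [add_self_of_Y_ne hy]
  refine ⟨some_ne_zero _, ?_, ?_⟩
  · simp only [xCoord_some, eta_some, addX, slope_of_Y_ne rfl hy, b₂, b₄, h6]
    generalize hd : 2 * y + W.a₁ * x + W.a₃ = d at *
    field_simp
    rw [← hd]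
    ring
  · simp only [xCoord_some, eta_some, addY, negAddY, negY, addX, slope_of_Y_ne rfl hy, b₂, b₄]
    have h7 : y - (-y - W.a₁ * x - W.a₃) = 2 * y + W.a₁ * x + W.a₃ := by ring
    rw [h7]
    generalize hd : 2 * y + W.a₁ * x + W.a₃ = d at *
    have h8 : y = (d - W.a₁ * x - W.a₃) / 2 := by rw [← hd]; ring
    subst h8
    field_simp
    ring

end AddFormulas

theorem eventually_eta_ne_zero [CharZero k] : ∀ᶠ P : W.Point in cofinite, eta P ≠ 0 := by
  filter_upwards [tendsto_xCoord.eventually (eventually_eval_ne_zero (W.Ψ₂Sq_ne_zero (by norm_num))),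
    eventually_ne_zero] with P h h0 h1
  rw [← eta_sq h0, h1] at h
  simp at h

section AlgClosed

variable [IsAlgClosed k] [CharZero k] [W.IsElliptic]

theorem exists_xCoord_eq (x : k) : ∃ P : W.Point, P ≠ 0 ∧ xCoord P = x := by
  obtain ⟨z, hz⟩ := IsAlgClosed.exists_pow_nat_eq (W.Ψ₂Sq.eval x) (n := 2) (by norm_num)
  rw [eval_Ψ₂Sq, b₂, b₄, b₆] at hz
  refine ⟨.mk (x := x) (y := (z - W.a₁ * x - W.a₃) / 2) ?_, some_ne_zero _, rfl⟩
  rw [equation_iff]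
  field_simp
  linear_combination hz

theorem eventually_xCoord_iff {p : k → Prop} :
    (∀ᶠ P : W.Point in cofinite, p (xCoord P)) ↔ ∀ᶠ x in cofinite, p x := by
  refine ⟨fun h => ?_, fun h => tendsto_xCoord.eventually h⟩
  rw [eventually_cofinite] at h ⊢
  refine (h.image xCoord).subset fun x hx => ?_
  obtain ⟨P, -, rfl⟩ := exists_xCoord_eq (W := W) x
  exact ⟨P, hx, rfl⟩

instance : Infinite W.Point := by
  rw [← Set.infinite_univ_iff]
  intro h
  refine Set.infinite_univ (α := k) ((h.image xCoord).subset fun x _ => ?_)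
  obtain ⟨P, -, rfl⟩ := exists_xCoord_eq (W := W) x
  exact ⟨P, trivial, rfl⟩

/-- The polynomial `4x³ + b₂x² + 2b₄x + b₆` has no common root with half its derivative. -/
theorem half_derivative_ne_zero {x : k} (h : W.Ψ₂Sq.eval x = 0) :
    6 * x ^ 2 + W.b₂ * x + W.b₄ ≠ 0 := by
  intro h2
  obtain ⟨P, hP, rfl⟩ := exists_xCoord_eq (W := W) x
  rw [← eta_sq hP] at h
  have h3 : eta P = 0 := by simpa using h
  rcases P with _ | ⟨x, y, h1⟩
  · exact hP rfl
  · rw [eta_some] at h3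
    rw [xCoord_some, b₂, b₄] at h2
    rcases ((W.nonsingular_iff' x y).1 h1).2 with h4 | h4
    · apply h4
      have : (2 : k) ≠ 0 := two_ne_zero
      apply mul_left_cancel₀ this
      linear_combination W.a₁ * h3 - h2
    · exact h4 h3

end AlgClosed

end WeierstrassCurve.Affine.Point

/-! ### Self-maps of the curve in coordinates, and multiplication by integers -/

namespace WeierstrassCurve.Affine.Point

variable {k : Type*} [Field k] {W : WeierstrassCurve.Affine k}

/-- Off a finite set, the map `φ` is given by `x ↦ X(x)`, `η ↦ B(x) η`,
where `η = 2y + a₁x + a₃`. -/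
def HasRep (φ : W.Point → W.Point) (X B : k → k) : Prop :=
  ∀ᶠ P in cofinite, φ P ≠ 0 ∧ xCoord (φ P) = X (xCoord P) ∧ eta (φ P) = B (xCoord P) * eta P

namespace HasRep

variable {φ ψ : W.Point → W.Point} {X X' B B' : k → k}

theorem id : HasRep (fun P : W.Point => P) (fun x => x) (fun _ => 1) := by
  filter_upwards [eventually_ne_zero] with P hP
  simp [hP]

theorem neg (h : HasRep φ X B) : HasRep (fun P => - φ P) X (fun x => - B x) := by
  filter_upwards [h] with P hP
  rw [xCoord_neg, eta_neg, hP.2.2, neg_mul]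
  exact ⟨fun h0 => hP.1 (by rw [← neg_neg (φ P), h0]; rfl), hP.2.1, rfl⟩

theorem comp (h : HasRep φ X B) (h' : HasRep ψ X' B') (ht : Tendsto ψ cofinite cofinite) :
    HasRep (fun P => φ (ψ P)) (fun x => X (X' x)) (fun x => B (X' x) * B' x) := by
  filter_upwards [ht.eventually h, h'] with P h1 h2
  rw [h1.2.1, h1.2.2, h2.2.1, h2.2.2, mul_assoc]
  exact ⟨h1.1, rfl, rfl⟩

section Add

variable [DecidableEq k] [CharZero k]

theorem add (h : HasRep φ X B) (h' : HasRep ψ X' B') (hX : ∀ᶠ x in cofinite, X x ≠ X' x) :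
    HasRep (fun P => φ P + ψ P)
      (fun x => W.Ψ₂Sq.eval x * ((B x - B' x) / (X x - X' x)) ^ 2 / 4 - W.b₂ / 4 - X x - X' x)
      (fun x => -((B x - B' x) / (X x - X' x) *
        (W.Ψ₂Sq.eval x * ((B x - B' x) / (X x - X' x)) ^ 2 / 4 - W.b₂ / 4 - X x - X' x - X x) +
          B x)) := by
  filter_upwards [h, h', tendsto_xCoord.eventually hX, eventually_ne_zero] with P h1 h2 h3 h4
  obtain ⟨e1, e2, e3⟩ := add_formula h1.1 h2.1 (by rwa [h1.2.1, h2.2.1])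
  rw [h1.2.1, h1.2.2, h2.2.1, h2.2.2] at e2
  rw [e2, h1.2.1, h1.2.2, h2.2.1, h2.2.2] at e3
  rw [e2, e3, ← eta_sq h4]
  refine ⟨e1, by ring, by ring⟩

theorem double [IsAlgClosed k] [W.IsElliptic] : HasRep (fun P : W.Point => P + P)
    (fun x => ((6 * x ^ 2 + W.b₂ * x + W.b₄) ^ 2 / W.Ψ₂Sq.eval x - W.b₂) / 4 - 2 * x)
    (fun x => -((6 * x ^ 2 + W.b₂ * x + W.b₄) / W.Ψ₂Sq.eval x *
      (((6 * x ^ 2 + W.b₂ * x + W.b₄) ^ 2 / W.Ψ₂Sq.eval x - W.b₂) / 4 - 2 * x - x) + 1)) := by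
  filter_upwards [eventually_ne_zero, eventually_eta_ne_zero] with P h1 h2
  obtain ⟨e1, e2, e3⟩ := double_formula h1 h2
  refine ⟨e1, ?_, ?_⟩
  · rw [e2, ← eta_sq h1]
    ring
  · rw [e3, e2, ← eta_sq h1]
    field_simp

end Add

section AlgClosed

variable [IsAlgClosed k] [CharZero k] [W.IsElliptic]

theorem eventually_eq (h : HasRep φ X B) (h' : HasRep φ X' B') :
    (∀ᶠ x in cofinite, X x = X' x) ∧ ∀ᶠ x in cofinite, B x = B' x := by
  constructor <;> rw [← eventually_xCoord_iff (W := W)]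
  · filter_upwards [h, h'] with P h1 h2
    rw [← h1.2.1, ← h2.2.1]
  · filter_upwards [h, h', eventually_eta_ne_zero] with P h1 h2 h3
    exact mul_right_cancel₀ h3 (by rw [← h1.2.2, ← h2.2.2])

theorem sq_mul_eval (h : HasRep φ X B) :
    ∀ᶠ x in cofinite, W.Ψ₂Sq.eval (X x) = B x ^ 2 * W.Ψ₂Sq.eval x := by
  rw [← eventually_xCoord_iff (W := W)]
  filter_upwards [h, eventually_ne_zero] with P h1 h2
  rw [← h1.2.1, ← eta_sq h1.1, h1.2.2, mul_pow, eta_sq h2]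

end AlgClosed

end HasRep

section Multiplication

theorem hasLim_Ψ₂Sq : HasLimAtInfty (fun x => W.Ψ₂Sq.eval x / x ^ 3) 4 := by
  have h0 := HasLimAtInfty.inv_id (k := k)
  have h := (((HasLimAtInfty.const (4 : k)).add ((HasLimAtInfty.const W.b₂).mul h0)).add
    ((HasLimAtInfty.const (2 * W.b₄)).mul (h0.pow 2))).add
      ((HasLimAtInfty.const W.b₆).mul (h0.pow 3))
  simp only [ne_eq, OfNat.ofNat_ne_zero, not_false_eq_true, zero_pow, mul_zero, add_zero] at h
  refine h.congr' ?_
  filter_upwards [(Set.finite_singleton (0 : k)).compl_mem_cofinite] with x hx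
  have hx' : x ≠ 0 := hx
  rw [eval_Ψ₂Sq]
  field_simp

variable [IsAlgClosed k] [CharZero k] [W.IsElliptic] [DecidableEq k]

/-- Near the origin of the group, multiplication by N scales the local parameter by N, so it scales
x by N⁻² and η by N⁻³. -/
theorem hasRep_nsmul_succ (n : ℕ) : ∃ X B : k → k,
    HasRep (fun P : W.Point => (n + 1) • P) X B ∧
      HasLimAtInfty (fun x => X x / x) (((n + 1 : k) ^ 2)⁻¹) ∧
      HasLimAtInfty B (((n + 1 : k) ^ 3)⁻¹) := by
  have hne : ∀ᶠ x : k in cofinite, x ≠ 0 := (Set.finite_singleton (0 : k)).compl_mem_cofinite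
  have hinv := HasLimAtInfty.inv_id (k := k)
  have hf := hasLim_Ψ₂Sq (W := W)
  have h4 : (4 : k) ≠ 0 := by norm_num
  rcases n with _ | n
  · refine ⟨_, _, by simpa using HasRep.id (W := W), ?_, ?_⟩
    · refine (HasLimAtInfty.const _).congr' ?_
      filter_upwards [hne] with x hx
      simp [hx]
    · simpa using HasLimAtInfty.const (1 : k)
  -- The chord formula cannot compute P + P, so doubling is the base case of the induction.
  induction n with
  | zero =>
    have hg : HasLimAtInfty (fun x => (6 * x ^ 2 + W.b₂ * x + W.b₄) / x ^ 2) 6 := by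
      have h := ((HasLimAtInfty.const (6 : k)).add ((HasLimAtInfty.const W.b₂).mul hinv)).add
        ((HasLimAtInfty.const W.b₄).mul (hinv.pow 2))
      simp only [ne_eq, OfNat.ofNat_ne_zero, not_false_eq_true, zero_pow, mul_zero, add_zero] at h
      refine h.congr' ?_
      filter_upwards [hne] with x hx
      field_simp
    have hX : HasLimAtInfty (fun x => (((6 * x ^ 2 + W.b₂ * x + W.b₄) ^ 2 / W.Ψ₂Sq.eval x - W.b₂) / 4
        - 2 * x) / x) 4⁻¹ := by
      have h := (((hg.pow 2).div hf h4).sub ((HasLimAtInfty.const W.b₂).mul hinv)).div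
        (HasLimAtInfty.const 4) h4 |>.sub (HasLimAtInfty.const 2)
      rw [show ((6 : k) ^ 2 / 4 - W.b₂ * 0) / 4 - 2 = 4⁻¹ by norm_num] at h
      refine h.congr' ?_
      filter_upwards [hne, hf.eventually_ne_zero h4] with x hx hx2
      have hx3 : W.Ψ₂Sq.eval x ≠ 0 := fun h0 => hx2 (by simp [h0])
      field_simp
    refine ⟨_, _, by simpa [two_nsmul] using HasRep.double (W := W), ?_, ?_⟩
    · convert hX using 1
      norm_num
    · have h := ((hg.div hf h4).mul (hX.sub (HasLimAtInfty.const 1))).add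
        (HasLimAtInfty.const 1) |>.neg
      convert h.congr' ?_ using 1
      · norm_num
      · filter_upwards [hne, hf.eventually_ne_zero h4] with x hx hx2
        have hx3 : W.Ψ₂Sq.eval x ≠ 0 := fun h0 => hx2 (by simp [h0])
        field_simp
        ring
  | succ n ih =>
    obtain ⟨X, B, hr, hX, hB⟩ := ih
    have hN : ∀ m : ℕ, (n + m + 1 : k) ≠ 0 := fun m => by
      have := Nat.cast_add_one_ne_zero (R := k) (n + m)
      rwa [Nat.cast_add] at this
    have n1 := hN 0
    have n2 := hN 1
    have n3 := hN 2
    have n4 : (n + 3 : k) ≠ 0 := by convert n3 using 1; push_cast; ring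
    have n5 : (n + 2 : k) ≠ 0 := by convert n2 using 1; push_cast; ring
    simp only [Nat.cast_zero, add_zero] at n1
    push_cast at hX hB ⊢
    have e0 : (n : k) + 1 + 1 = n + 2 := by ring
    have e4 : (n : k) + 2 + 1 = n + 3 := by ring
    rw [e0] at hX hB ⊢
    rw [e4]
    -- The value of X/x - 1 at infinity is nonzero, so (n+2)P and P have distinct abscissas off a
    -- finite set and the chord formula applies.
    have e1 : ((n + 2 : k) ^ 2)⁻¹ - 1 = -((n + 1) * (n + 3) / (n + 2) ^ 2) := by
      field_simp; ring
    have e2 : ((n + 2 : k) ^ 2)⁻¹ - 1 ≠ 0 := by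
      rw [e1]
      exact neg_ne_zero.2 (div_ne_zero (mul_ne_zero n1 n4) (pow_ne_zero _ n5))
    have e3 : ((n + 2 : k) ^ 3)⁻¹ - 1 = -((n + 1) * (n ^ 2 + 5 * n + 7) / (n + 2) ^ 3) := by
      field_simp; ring
    have hd := hX.sub (HasLimAtInfty.const 1)
    have hXne : ∀ᶠ x in cofinite, X x - x ≠ 0 := by
      filter_upwards [hne, hd.eventually_ne_zero e2] with x hx hx1 hx2
      refine hx1 ?_
      rw [sub_eq_zero.1 hx2, div_self hx, sub_self]
    have hm := (hB.sub (HasLimAtInfty.const 1)).div hd e2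
    have hX' := ((((hf.mul (hm.pow 2)).div (HasLimAtInfty.const 4) h4).sub
      ((HasLimAtInfty.const (W.b₂ / 4)).mul hinv)).sub hX).sub (HasLimAtInfty.const 1)
    have hB' := ((hm.mul (hX'.sub hX)).add hB).neg
    have hadd := hr.add HasRep.id (by filter_upwards [hXne] with x hx using sub_ne_zero.1 hx)
    refine ⟨_, _, by simpa only [succ_nsmul _ (n + 1 + 1)] using hadd, ?_, ?_⟩
    · convert hX'.congr' ?_ using 1
      · rw [e1, e3]
        field_simp
        ring
      · filter_upwards [hne, hXne] with x hx hx1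
        have hx2 : X x / x - 1 = (X x - x) / x := by field_simp
        rw [hx2]
        field_simp
    · convert hB'.congr' ?_ using 1
      · rw [e1, e3]
        field_simp
        ring
      · filter_upwards [hne, hXne] with x hx hx1
        have hx2 : X x / x - 1 = (X x - x) / x := by field_simp
        rw [hx2]
        field_simp

end Multiplication

end WeierstrassCurve.Affine.Point

/-! ### Poles at infinity and the values they force -/

namespace HasLimAtInfty

variable {k : Type*} [Field k] {s : k → k} {c : k}

theorem pole_of_div_pow {n : ℕ} (hn : n ≠ 0) (h : HasLimAtInfty (fun x => s x / x ^ n) c)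
    (hc : c ≠ 0) :
    HasLimAtInfty (fun x => (s x)⁻¹) 0 ∧ ∀ᶠ x in cofinite, s x ≠ 0 := by
  have h1 := (h.inv hc).mul ((inv_id (k := k)).pow n)
  rw [zero_pow hn, mul_zero] at h1
  constructor
  · refine h1.congr' ?_
    filter_upwards [(Set.finite_singleton (0 : k)).compl_mem_cofinite] with x hx
    have hx' : x ≠ 0 := hx
    rw [inv_div, inv_pow, div_eq_mul_inv, mul_comm (x ^ n), mul_assoc,
      mul_inv_cancel₀ (pow_ne_zero n hx'), mul_one]
  · filter_upwards [h.eventually_ne_zero hc] with x hx h0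
    exact hx (by rw [h0, zero_div])

theorem pole_of_div (h : HasLimAtInfty (fun x => s x / x) c) (hc : c ≠ 0) :
    HasLimAtInfty (fun x => (s x)⁻¹) 0 ∧ ∀ᶠ x in cofinite, s x ≠ 0 :=
  pole_of_div_pow one_ne_zero (by simpa using h) hc

/-- A rational function with a simple pole at infinity takes almost every value,
even outside a finite set. -/
theorem eventually_exists_eq [IsAlgClosed k] (h : HasLimAtInfty (fun x => s x / x) c) (hc : c ≠ 0)
    {S : Set k} (hS : S.Finite) : ∀ᶠ y in cofinite, ∃ x ∉ S, s x = y := by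
  classical
  obtain ⟨n, p, q, hp, hq, hn, hpq, h⟩ := h
  have hq0 : q ≠ 0 := fun h0 => hn (by simp [h0])
  have hpn : p.coeff n ≠ 0 := by rw [hpq]; exact mul_ne_zero hc hn
  have hp0 : p ≠ 0 := fun h0 => hpn (by simp [h0])
  have hpd : p.natDegree = n := natDegree_eq_of_le_of_coeff_ne_zero hp hpn
  have hqd : q.natDegree = n := natDegree_eq_of_le_of_coeff_ne_zero hq hn
  set u := X * p with hu
  have hu0 : u ≠ 0 := mul_ne_zero X_ne_zero hp0
  have hud : u.natDegree = n + 1 := by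
    rw [hu, natDegree_mul X_ne_zero hp0, natDegree_X, hpd, add_comm]
  set g := EuclideanDomain.gcd u q with hg
  have hg0 : g ≠ 0 := fun h0 => hq0 (EuclideanDomain.gcd_eq_zero_iff.1 h0).2
  obtain ⟨u', hu'⟩ := EuclideanDomain.gcd_dvd_left u q
  obtain ⟨q', hq'⟩ := EuclideanDomain.gcd_dvd_right u q
  rw [← hg] at hu' hq'
  have hu0' : u' ≠ 0 := by rintro rfl; exact hu0 (by rw [hu', mul_zero])
  have hq0' : q' ≠ 0 := by rintro rfl; exact hq0 (by rw [hq', mul_zero])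
  -- The numerator x·p has degree n + 1 against n, so u' - y q' is nonconstant for every y and has a
  -- root.
  have hlt : q'.natDegree < u'.natDegree := by
    have e1 := natDegree_mul hg0 hu0'
    have e2 := natDegree_mul hg0 hq0'
    rw [← hu', hud] at e1
    rw [← hq', hqd] at e2
    omega
  have hcop : IsCoprime u' q' := by
    have h1 := EuclideanDomain.gcd_eq_gcd_ab u q
    rw [← hg] at h1
    refine ⟨EuclideanDomain.gcdA u q, EuclideanDomain.gcdB u q, mul_left_cancel₀ hg0 ?_⟩
    linear_combination -h1 - EuclideanDomain.gcdA u q * hu' - EuclideanDomain.gcdB u q * hq'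
  -- The abscissas to avoid; only the finitely many y that come from them are lost.
  set Z : Set k := {x | ¬ (s x / x = p.eval x / q.eval x)} ∪ S ∪ {0} ∪ {x | ¬ g.eval x ≠ 0}
    with hZ
  have hZf : Z.Finite := ((((eventually_cofinite.1 h).union hS).union
    (Set.finite_singleton 0)).union (eventually_cofinite.1 (eventually_eval_ne_zero hg0)))
  filter_upwards [(hZf.image fun x => u'.eval x / q'.eval x).compl_mem_cofinite] with y hy
  have hdeg : (u' - C y * q').natDegree = u'.natDegree :=
    natDegree_sub_eq_left_of_natDegree_lt ((natDegree_C_mul_le _ _).trans_lt hlt)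
  obtain ⟨x, hx⟩ := IsAlgClosed.exists_root (u' - C y * q') (fun hd => by
    have hd' : (u' - C y * q').natDegree = 0 := natDegree_eq_of_degree_eq_some hd
    omega)
  rw [IsRoot, eval_sub, eval_mul, eval_C, sub_eq_zero] at hx
  have hqx : q'.eval x ≠ 0 := by
    intro h0
    obtain ⟨a, b, hab⟩ := hcop
    have := congrArg (eval x) hab
    rw [eval_add, eval_mul, eval_mul, h0, hx, h0] at this
    simp at this
  have hxy : u'.eval x / q'.eval x = y := by rw [hx, mul_div_cancel_right₀ _ hqx]
  have hxZ : x ∉ Z := fun hxZ => hy ⟨x, hxZ, hxy⟩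
  simp only [hZ, Set.mem_union, Set.mem_ofPred_eq, Set.mem_singleton_iff, not_or, not_not] at hxZ
  obtain ⟨⟨⟨h1, h2⟩, h3⟩, h4⟩ := hxZ
  refine ⟨x, h2, ?_⟩
  rw [← hxy, ← mul_div_mul_left _ _ h4, ← eval_mul, ← eval_mul, ← hu', ← hq', hu, eval_mul, eval_X,
    mul_div_assoc, ← h1, mul_div_cancel₀ _ h3]

end HasLimAtInfty

/-! ### Divisibility of the group of points, and endomorphisms whose square is an integer -/

namespace WeierstrassCurve.Affine.Point

variable {k : Type*} [Field k] {W : WeierstrassCurve.Affine k}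

theorem HasRep.tendsto_cofinite [Infinite k] {φ : W.Point → W.Point} {X B : k → k}
    (h : HasRep φ X B) (hX : HasLimAtInfty (fun x => (X x)⁻¹) 0)
    (hX0 : ∀ᶠ x in cofinite, X x ≠ 0) : Tendsto φ cofinite cofinite := by
  refine Tendsto.cofinite_of_finite_preimage_singleton fun Q => ?_
  have h1 := ((HasLimAtInfty.tendsto_cofinite hX hX0).comp
    (tendsto_xCoord (W := W))).eventually
    ((Set.finite_singleton (xCoord Q)).compl_mem_cofinite)
  refine (eventually_cofinite.1 (h.and h1)).subset fun P hP hP2 => ?_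
  simp only [Set.mem_preimage, Set.mem_singleton_iff] at hP
  exact hP2.2 (by rw [Function.comp, ← hP2.1.2.1, hP]; rfl)

/-- Any a is a difference (a + b) - b, and for all but finitely many b both terms lie in the range.
-/
theorem surjective_of_eventually_mem_range {A : Type*} [AddGroup A] [Infinite A] (φ : A →+ A)
    (h : ∀ᶠ a in cofinite, a ∈ φ.range) : Function.Surjective φ := by
  intro a
  have h2 := (add_right_injective a).tendsto_cofinite.eventually h
  obtain ⟨b, hb, hb'⟩ := (h.and h2).exists
  have := φ.range.sub_mem hb' hb
  rwa [add_sub_cancel_right] at this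

variable [IsAlgClosed k] [CharZero k] [W.IsElliptic] [DecidableEq k]

/-- Almost every abscissa is a value of X; the sign ambiguity is absorbed by replacing P by -P. -/
theorem HasRep.surjective {φ : W.Point →+ W.Point} {X B : k → k} {c : k} (h : HasRep φ X B)
    (hX : HasLimAtInfty (fun x => X x / x) c) (hc : c ≠ 0) : Function.Surjective φ := by
  apply surjective_of_eventually_mem_range
  have h1 := hX.eventually_exists_eq hc ((eventually_cofinite.1 h).image xCoord)
  filter_upwards [tendsto_xCoord.eventually h1, eventually_ne_zero] with Q hQ hQ0
  obtain ⟨x, hx, hxQ⟩ := hQ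
  obtain ⟨P, hP0, rfl⟩ := exists_xCoord_eq (W := W) x
  have hP : φ P ≠ 0 ∧ xCoord (φ P) = X (xCoord P) ∧ eta (φ P) = B (xCoord P) * eta P := by
    by_contra hP
    exact hx ⟨P, hP, rfl⟩
  rcases eq_or_eq_neg_of_xCoord_eq hP.1 hQ0 (hP.2.1.trans hxQ) with h | h
  · exact ⟨P, h⟩
  · exact ⟨-P, by rw [map_neg, h, neg_neg]⟩

theorem nsmul_surjective {n : ℕ} (hn : n ≠ 0) : Function.Surjective fun P : W.Point => n • P := by
  obtain ⟨n, rfl⟩ := Nat.exists_eq_succ_of_ne_zero hn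
  obtain ⟨X, B, h, hX, hB⟩ := hasRep_nsmul_succ (W := W) n
  exact HasRep.surjective (φ := nsmulAddMonoidHom (n + 1)) h hX
    (inv_ne_zero (pow_ne_zero _ (Nat.cast_add_one_ne_zero n)))

theorem hasRep_zsmul {m : ℤ} (hm : m ≠ 0) : ∃ X B : k → k,
    HasRep (fun P : W.Point => m • P) X B ∧
      HasLimAtInfty (fun x => X x / x) (((m : k) ^ 2)⁻¹) ∧
      HasLimAtInfty B (((m : k) ^ 3)⁻¹) := by
  obtain ⟨n, hn⟩ := Nat.exists_eq_succ_of_ne_zero (Int.natAbs_ne_zero.2 hm)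
  obtain ⟨X, B, h, hX, hB⟩ := hasRep_nsmul_succ (W := W) n
  rcases Int.natAbs_eq m with h1 | h1
  · rw [hn] at h1
    subst h1
    exact ⟨X, B, by simpa only [natCast_zsmul] using h, by simpa using hX, by simpa using hB⟩
  · rw [hn] at h1
    subst h1
    refine ⟨X, _, by simpa only [natCast_zsmul, neg_smul] using h.neg, ?_, ?_⟩
    · convert hX using 1
      push_cast
      rw [neg_sq]
    · convert hB.neg using 1
      push_cast
      rw [Odd.neg_pow (by decide), inv_neg]

theorem tendsto_zsmul_cofinite {m : ℤ} (hm : m ≠ 0) :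
    Tendsto (fun P : W.Point => m • P) cofinite cofinite := by
  obtain ⟨X, B, h, hX, hB⟩ := hasRep_zsmul (W := W) hm
  obtain ⟨h1, h2⟩ := hX.pole_of_div (inv_ne_zero (pow_ne_zero _ (Int.cast_ne_zero.2 hm)))
  exact h.tendsto_cofinite h1 h2

section SquareRoot

variable {φ : W.Point →+ W.Point} {m : ℤ} {X B : k → k}

/-- A fibre of φ lies inside a fibre of φ² = [m], which is finite. -/
theorem tendsto_cofinite_of_sq (hm : m ≠ 0) (hφ : ∀ P, φ (φ P) = m • P) :
    Tendsto φ cofinite cofinite := by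
  refine Tendsto.cofinite_of_finite_preimage_singleton fun Q => ?_
  have := (tendsto_zsmul_cofinite (W := W) hm).eventually
    ((Set.finite_singleton (φ Q)).compl_mem_cofinite)
  refine (eventually_cofinite.1 this).subset fun P hP hP2 => hP2 ?_
  rw [Set.mem_singleton_iff, ← hφ P]
  exact congrArg φ hP

/-- If the `x`-coordinate of an endomorphism is finite at infinity, its value there is the
abscissa of a point of order two. -/
theorem HasRep.eval_eq_zero_of_hasLim {φ : W.Point → W.Point} (h : HasRep φ X B)
    (hB : IsRationalFun B) {c : k} (hX : HasLimAtInfty X c) : W.Ψ₂Sq.eval c = 0 := by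
  by_contra hc
  obtain ⟨p, q, hq, hpq⟩ := hB
  have h1 := (hX.polynomial_eval W.Ψ₂Sq)
  obtain ⟨n, a, b, ha, hb, hbn, han, hab⟩ := h1
  have han0 : a.coeff n ≠ 0 := by rw [han]; exact mul_ne_zero hc hbn
  have ha0 : a ≠ 0 := fun h0 => han0 (by simp [h0])
  have hb0 : b ≠ 0 := fun h0 => hbn (by simp [h0])
  have hΨ0 : W.Ψ₂Sq ≠ 0 := W.Ψ₂Sq_ne_zero (by norm_num)
  have hΨ : W.Ψ₂Sq.natDegree = 3 := W.natDegree_Ψ₂Sq (by norm_num)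
  have key : p ^ 2 * W.Ψ₂Sq * b = q ^ 2 * a := by
    apply eq_of_eventually_eval_eq
    filter_upwards [hpq, hab, h.sq_mul_eval, eventually_eval_ne_zero hq,
      eventually_eval_ne_zero hb0] with x h1 h2 h3 h4 h5
    rw [h3, h1] at h2
    simp only [eval_mul, eval_pow]
    field_simp at h2
    linear_combination h2
  have hp0 : p ≠ 0 := by
    rintro rfl
    simp [hq, ha0] at key
  -- Parity contradiction: apart from the common degree n, the left side has odd degree 2 deg p + 3
  -- and the right side even degree 2 deg q.
  have hd := congrArg natDegree key
  rw [natDegree_mul (mul_ne_zero (pow_ne_zero _ hp0) hΨ0) hb0,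
    natDegree_mul (pow_ne_zero _ hp0) hΨ0, natDegree_mul (pow_ne_zero _ hq) ha0, natDegree_pow,
    natDegree_pow, hΨ, natDegree_eq_of_le_of_coeff_ne_zero ha han0,
    natDegree_eq_of_le_of_coeff_ne_zero hb hbn] at hd
  omega

/-- A homomorphism must send infinity to infinity. A finite value c would be the abscissa of a point
of order two. As φ commutes with doubling, X would keep the value c after doubling, while the
doubling formula has a pole at c. -/
theorem HasRep.not_hasLim_X (hφ : Tendsto φ cofinite cofinite) (h : HasRep φ X B)
    (hB : IsRationalFun B) (c : k) : ¬ HasLimAtInfty X c := by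
  intro hX
  have hc := h.eval_eq_zero_of_hasLim hB hX
  have h2 := HasRep.double (W := W)
  obtain ⟨X2, B2, h2', hX2, -⟩ := hasRep_nsmul_succ (W := W) 1
  have h4 : (((1 : ℕ) : k) + 1 : k) ^ 2 ≠ 0 := by norm_num
  have ht : Tendsto (fun P : W.Point => (1 + 1) • P) cofinite cofinite := by
    obtain ⟨p1, p2⟩ := hX2.pole_of_div (inv_ne_zero h4)
    exact h2'.tendsto_cofinite p1 p2
  have hcomm : (fun P : W.Point => φ ((1 + 1) • P)) = fun P => φ P + φ P := by
    funext P
    rw [map_nsmul, add_nsmul, one_nsmul]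
  have hl := h.comp h2' ht
  rw [hcomm] at hl
  have hr := h2.comp h hφ
  have hlim := hX.comp (hX2.pole_of_div (inv_ne_zero h4)).1 (hX2.pole_of_div (inv_ne_zero h4)).2
  have hlim' := hlim.congr' (hr.eventually_eq hl).1
  have hne : ∀ᶠ x in cofinite, W.Ψ₂Sq.eval (X x) ≠ 0 := by
    rw [← eventually_xCoord_iff (W := W)]
    filter_upwards [h, hφ.eventually eventually_eta_ne_zero] with P h1 h2
    rw [← h1.2.1, ← eta_sq h1.1]
    exact pow_ne_zero _ h2
  -- The doubling formula with its denominator cleared: at c it says that the square of 6c² + b₂c +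
  -- b₄ is a multiple of Ψ₂Sq(c) = 0.
  have hc1 := (((hlim'.add (hX.mul (HasLimAtInfty.const 2))).mul (HasLimAtInfty.const 4)).add
    (HasLimAtInfty.const W.b₂)).mul (hX.polynomial_eval W.Ψ₂Sq)
  have hc2 := (hX.polynomial_eval (C 6 * Polynomial.X ^ 2 + C W.b₂ * Polynomial.X + C W.b₄)).pow 2
  simp only [eval_add, eval_mul, eval_C, eval_pow, eval_X] at hc2
  have hc3 := hc2.unique (hc1.congr' (by
    filter_upwards [hne] with x hx
    field_simp
    ring))
  rw [hc, mul_zero] at hc3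
  exact half_derivative_ne_zero hc (by simpa using hc3)

/-- The number κ/β is the factor by which φ scales the invariant differential dx/η, since the
pullback is (X'/B)·dx/η. Comparing φ² with [m] gives κ² = m⁻² and β² = m⁻³, whence (κ/β)² = m. -/
theorem HasRep.exists_hasLim_of_sq (hm : m ≠ 0) (hφ : ∀ P, φ (φ P) = m • P) (h : HasRep φ X B)
    (hX : IsRationalFun X) (hB : IsRationalFun B) :
    ∃ κ β : k, HasLimAtInfty (fun x => X x / x) κ ∧ HasLimAtInfty B β ∧ β ≠ 0 ∧
      (κ / β) ^ 2 = m := by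
  have ht := tendsto_cofinite_of_sq hm hφ
  have hmk : (m : k) ≠ 0 := Int.cast_ne_zero.2 hm
  have hne : ∀ᶠ x : k in cofinite, x ≠ 0 := (Set.finite_singleton (0 : k)).compl_mem_cofinite
  obtain ⟨Xm, Bm, hrm, hXm, hBm⟩ := hasRep_zsmul (W := W) hm
  have hsq := h.comp h ht
  simp only [hφ] at hsq
  obtain ⟨eX, eB⟩ := hsq.eventually_eq hrm
  rcases hX.exists_hasLimAtInfty with ⟨c, hc⟩ | ⟨e, κ, he, hκ, hXe⟩
  · exact (h.not_hasLim_X ht hB c hc).elim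
  obtain ⟨hp, hp0⟩ := hXe.pole_of_div_pow he hκ
  have hXX := (hXe.comp hp hp0).mul (hXe.pow e)
  -- X ∘ X grows like the power e² of x, whereas the abscissa of [m] grows like x.
  have e1 : e = 1 := by
    have h1 := (hXX.div hXm (inv_ne_zero (pow_ne_zero 2 hmk)))
    obtain ⟨d, hd⟩ : ∃ d, e * e = d + 1 :=
      ⟨e * e - 1, (Nat.succ_pred_eq_of_pos (Nat.mul_pos (Nat.pos_of_ne_zero he)
        (Nat.pos_of_ne_zero he))).symm⟩
    have h2 : HasLimAtInfty (fun x : k => (x⁻¹) ^ d) (κ * κ ^ e / ((m : k) ^ 2)⁻¹) := by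
      refine h1.congr' ?_
      filter_upwards [hne, hp0, eX, hXm.eventually_ne_zero (inv_ne_zero (pow_ne_zero 2 hmk))]
        with x h3 h4 h5 h6
      have h7 : Xm x ≠ 0 := fun h0 => h6 (by rw [h0, zero_div])
      rw [h5, div_pow, ← pow_mul, hd, pow_succ]
      field_simp
      rw [← mul_pow, one_div, inv_mul_cancel₀ h3, one_pow]
    have h3 := h2.inv (div_ne_zero (mul_ne_zero hκ (pow_ne_zero _ hκ))
      (inv_ne_zero (pow_ne_zero 2 hmk)))
    have h4 : d = 0 := HasLimAtInfty.zero_of_pow (by simpa using h3)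
    rw [h4] at hd
    nlinarith [Nat.pos_of_ne_zero he]
  subst e1
  simp only [pow_one] at hXe hXX
  have hκ2 : κ ^ 2 = ((m : k) ^ 2)⁻¹ := by
    rw [pow_two]
    refine hXX.unique (hXm.congr' ?_)
    filter_upwards [hp0, eX] with x h1 h2
    rw [h2]
    field_simp
  -- The curve equation at φ(P) gives B² = Ψ₂Sq(X)/Ψ₂Sq(x), which behaves like (X/x)³.
  have hB2 : HasLimAtInfty (fun x => B x ^ 2) (κ ^ 3) := by
    have hΨ := hasLim_Ψ₂Sq (W := W)
    have h4 : (4 : k) ≠ 0 := by norm_num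
    have h1 := ((hΨ.comp hp hp0).mul (hXe.pow 3)).div hΨ h4
    rw [mul_div_cancel_left₀ _ h4] at h1
    refine h1.congr' ?_
    filter_upwards [hne, hp0, h.sq_mul_eval, hΨ.eventually_ne_zero h4] with x h1 h2 h3 h5
    have h6 : W.Ψ₂Sq.eval x ≠ 0 := fun h0 => h5 (by simp [h0])
    rw [h3]
    field_simp
  have hκ3 : κ ^ 3 ≠ 0 := pow_ne_zero _ hκ
  obtain ⟨β, hβ⟩ : ∃ β, HasLimAtInfty B β := by
    rcases hB.exists_hasLimAtInfty with h1 | ⟨n, c, hn, hc, h1⟩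
    · exact h1
    · have h2 := hB2.div (h1.pow 2) (pow_ne_zero 2 hc)
      refine (hn ?_).elim
      have h3 : HasLimAtInfty (fun x : k => x ^ (n * 2)) (κ ^ 3 / c ^ 2) := by
        refine h2.congr' ?_
        filter_upwards [hne, hB2.eventually_ne_zero hκ3] with x h4 h5
        have h6 : B x ≠ 0 := fun h0 => h5 (by simp [h0])
        rw [pow_mul]
        field_simp
      simpa using h3.zero_of_pow
  have hβ3 : β ^ 2 = κ ^ 3 := (hβ.pow 2).unique hB2
  have hβm : β ^ 2 = ((m : k) ^ 3)⁻¹ := by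
    rw [pow_two]
    exact ((hβ.comp hp hp0).mul hβ).unique (hBm.congr' eB)
  have hβ0 : β ≠ 0 := by
    rintro rfl
    exact hκ3 (by rw [← hβ3]; simp)
  refine ⟨κ, β, hXe, hβ, hβ0, ?_⟩
  rw [div_pow, hκ2, hβm]
  field_simp

end SquareRoot

end WeierstrassCurve.Affine.Point

/-! ### From rational functions of (x, y) to functions of x alone -/

namespace WeierstrassCurve.Affine.Point

variable {k : Type*} [Field k] {W : WeierstrassCurve.Affine k} [CharZero k]

theorem exists_reduction {F : Type*} [Field F] [Algebra F k] (Q : MvPolynomial (Fin 2) F) :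
    ∃ g₀ g₁ : k[X], ∀ x y (h : W.Nonsingular x y),
      MvPolynomial.aeval ![x, y] Q = g₀.eval x + g₁.eval x * eta (.some x y h) := by
  induction Q using MvPolynomial.induction_on with
  | C a => exact ⟨C (algebraMap F k a), 0, fun x y h => by simp⟩
  | add p q hp hq =>
    obtain ⟨p₀, p₁, hp⟩ := hp
    obtain ⟨q₀, q₁, hq⟩ := hq
    refine ⟨p₀ + q₀, p₁ + q₁, fun x y h => ?_⟩
    rw [map_add, hp x y h, hq x y h, eval_add, eval_add]
    ring
  | mul_X p i hp =>
    obtain ⟨p₀, p₁, hp⟩ := hp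
    fin_cases i
    · refine ⟨p₀ * X, p₁ * X, fun x y h => ?_⟩
      rw [map_mul, hp x y h]
      simp only [Fin.zero_eta, MvPolynomial.aeval_X, Matrix.cons_val_zero, eval_mul, eval_X]
      ring
    · refine ⟨C 2⁻¹ * (p₁ * W.Ψ₂Sq - (C W.a₁ * X + C W.a₃) * p₀),
        C 2⁻¹ * (p₀ - (C W.a₁ * X + C W.a₃) * p₁), fun x y h => ?_⟩
      have h1 := eta_sq (some_ne_zero h)
      rw [xCoord_some] at h1
      rw [map_mul, hp x y h]
      simp only [Fin.mk_one, MvPolynomial.aeval_X, Matrix.cons_val_one, Matrix.cons_val_fin_one,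
        eval_mul, eval_X, eval_sub, eval_add, eval_C]
      rw [← h1]
      have h2 : y = 2⁻¹ * (eta (.some x y h) - W.a₁ * x - W.a₃) := by
        rw [eta_some]; field_simp; ring
      generalize eta (.some x y h) = t at *
      subst h2
      ring

/-- This is the norm of d₀ + d₁η; it cannot vanish because Ψ₂Sq has odd degree. -/
theorem norm_ne_zero {d₀ d₁ : k[X]} (h : ¬ (d₀ = 0 ∧ d₁ = 0)) :
    d₀ ^ 2 - d₁ ^ 2 * W.Ψ₂Sq ≠ 0 := by
  intro h0
  rw [sub_eq_zero] at h0
  have hΨ0 : W.Ψ₂Sq ≠ 0 := W.Ψ₂Sq_ne_zero (by norm_num)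
  have hΨ : W.Ψ₂Sq.natDegree = 3 := W.natDegree_Ψ₂Sq (by norm_num)
  by_cases h1 : d₁ = 0
  · subst h1
    exact h ⟨by simpa using h0, rfl⟩
  · have hd := congrArg natDegree h0
    rw [natDegree_mul (pow_ne_zero _ h1) hΨ0, natDegree_pow, natDegree_pow, hΨ] at hd
    omega

variable [IsAlgClosed k] [W.IsElliptic] [DecidableEq k]

/-- Since φ(-P) = -φ(P), the abscissa of φ(P) is even in η and its η-coordinate is odd.
Rationalising the denominator and averaging over ±P leaves X(x) and B(x)η. -/
theorem exists_hasRep {F : Type*} [Field F] [Algebra F k] {φ : W.Point →+ W.Point}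
    {a b d : MvPolynomial (Fin 2) F}
    (hφ : {P : W.Point | ¬ ∃ x y h h', P = .some x y h ∧ MvPolynomial.aeval ![x, y] d ≠ 0 ∧
      φ P = .some (MvPolynomial.aeval ![x, y] a / MvPolynomial.aeval ![x, y] d)
        (MvPolynomial.aeval ![x, y] b / MvPolynomial.aeval ![x, y] d) h'}.Finite) :
    ∃ X B : k → k, IsRationalFun X ∧ IsRationalFun B ∧ HasRep φ X B := by
  obtain ⟨a₀, a₁, ha⟩ := exists_reduction (W := W) a
  obtain ⟨b₀, b₁, hb⟩ := exists_reduction (W := W) b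
  obtain ⟨d₀, d₁, hd⟩ := exists_reduction (W := W) d
  have h1 : ∀ᶠ P : W.Point in cofinite, φ P ≠ 0 ∧
      d₀.eval (xCoord P) + d₁.eval (xCoord P) * eta P ≠ 0 ∧
      xCoord (φ P) * (d₀.eval (xCoord P) + d₁.eval (xCoord P) * eta P) =
        a₀.eval (xCoord P) + a₁.eval (xCoord P) * eta P ∧
      eta (φ P) * (d₀.eval (xCoord P) + d₁.eval (xCoord P) * eta P) =
        2 * (b₀.eval (xCoord P) + b₁.eval (xCoord P) * eta P) +
        W.a₁ * (a₀.eval (xCoord P) + a₁.eval (xCoord P) * eta P) +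
        W.a₃ * (d₀.eval (xCoord P) + d₁.eval (xCoord P) * eta P) := by
    filter_upwards [eventually_cofinite.2 hφ] with P hP
    obtain ⟨x, y, h, h', rfl, h1, h2⟩ := hP
    rw [xCoord_some, ← ha x y h, ← hb x y h, ← hd x y h, h2, eta_some h', xCoord_some h']
    refine ⟨some_ne_zero _, h1, div_mul_cancel₀ _ h1, ?_⟩
    field_simp
  have h2 := (neg_injective (G := W.Point)).tendsto_cofinite.eventually h1
  have hN : d₀ ^ 2 - d₁ ^ 2 * W.Ψ₂Sq ≠ 0 := norm_ne_zero (by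
    rintro ⟨rfl, rfl⟩
    obtain ⟨P, hP⟩ := h1.exists
    simp at hP)
  refine ⟨_, _, ⟨a₀ * d₀ - a₁ * d₁ * W.Ψ₂Sq, _, hN, .of_forall fun x => rfl⟩,
    ⟨(2 * b₁ + C W.a₁ * a₁ + C W.a₃ * d₁) * d₀ - (2 * b₀ + C W.a₁ * a₀ + C W.a₃ * d₀) * d₁, _, hN,
      .of_forall fun x => rfl⟩, ?_⟩
  filter_upwards [h1, h2, eventually_ne_zero, eventually_eta_ne_zero,
    tendsto_xCoord.eventually (eventually_eval_ne_zero hN)] with P h1 h2 h3 h4 h5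
  obtain ⟨e1, e2, e3, e4⟩ := h1
  obtain ⟨-, f2, f3, f4⟩ := h2
  rw [map_neg, xCoord_neg, xCoord_neg, eta_neg] at f3
  rw [map_neg, xCoord_neg, eta_neg, eta_neg] at f4
  rw [xCoord_neg, eta_neg] at f2
  have hη := eta_sq h3
  simp only [eval_sub, eval_mul, eval_pow, eval_add, eval_C, eval_ofNat] at h5 ⊢
  rw [← hη] at h5 ⊢
  generalize eta P = t at *
  generalize eval (xCoord P) a₀ = A₀ at *
  generalize eval (xCoord P) a₁ = A₁ at *
  generalize eval (xCoord P) b₀ = B₀ at *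
  generalize eval (xCoord P) b₁ = B₁ at *
  generalize eval (xCoord P) d₀ = D₀ at *
  generalize eval (xCoord P) d₁ = D₁ at *
  refine ⟨e1, ?_, ?_⟩
  · rw [eq_div_iff h5]
    have h2 : (2 : k) ≠ 0 := two_ne_zero
    apply mul_left_cancel₀ h2
    linear_combination (D₀ - D₁ * t) * e3 + (D₀ + D₁ * t) * f3
  · rw [div_mul_eq_mul_div, eq_div_iff h5]
    have h2 : (2 : k) ≠ 0 := two_ne_zero
    apply mul_left_cancel₀ h2
    linear_combination (D₀ - D₁ * t) * e4 - (D₀ + D₁ * t) * f4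

end WeierstrassCurve.Affine.Point

end

/-! ### Galois conjugation of endomorphisms -/

noncomputable section

open Filter WeierstrassCurve.Affine.Point

namespace HasLimAtInfty

open Polynomial

theorem conj {k : Type*} [Field k] {r : k → k} {c : k} (h : HasLimAtInfty r c) (σ : k ≃+* k) :
    HasLimAtInfty (fun x => σ (r (σ.symm x))) (σ c) := by
  obtain ⟨n, p, q, hp, hq, hn, hc, h⟩ := h
  refine ⟨n, p.map σ.toRingHom, q.map σ.toRingHom, natDegree_map_le.trans hp,
    natDegree_map_le.trans hq, ?_, ?_, ?_⟩
  · rw [coeff_map]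
    exact (_root_.map_ne_zero _).2 hn
  · rw [coeff_map, coeff_map, hc, map_mul]
    rfl
  · filter_upwards [σ.symm.injective.tendsto_cofinite.eventually h] with x hx
    have key : ∀ P : k[X], (P.map σ.toRingHom).eval x = σ (P.eval (σ.symm x)) := by
      intro P
      conv_lhs => rw [← σ.apply_symm_apply x]
      exact eval_map_apply σ.toRingHom (σ.symm x)
    rw [key, key, hx, map_div₀]

end HasLimAtInfty

namespace WeierstrassCurve

variable {K : Type*} [Field K] {E : WeierstrassCurve K}

open scoped Classical in
/-- The action of the absolute Galois group on the geometric points. -/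
def galPoint (σ : Gal(AlgebraicClosure K/K)) : AddMonoid.End E.GeomPoint :=
  Affine.Point.map (W' := E) σ.toAlgHom

open scoped Classical in
theorem galPoint_mul (σ τ : Gal(AlgebraicClosure K/K)) (P : E.GeomPoint) :
    galPoint (σ * τ) P = galPoint σ (galPoint τ P) := by
  rcases P with _ | _ <;> rfl

open scoped Classical in
theorem galPoint_one (P : E.GeomPoint) : galPoint (1 : Gal(AlgebraicClosure K/K)) P = P := by
  rcases P with _ | _ <;> rfl

open scoped Classical in
theorem galPoint_inv_apply (σ : Gal(AlgebraicClosure K/K)) (P : E.GeomPoint) :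
    galPoint σ⁻¹ (galPoint σ P) = P := by
  rw [← galPoint_mul, inv_mul_cancel, galPoint_one]

open scoped Classical in
theorem galPoint_apply_inv (σ : Gal(AlgebraicClosure K/K)) (P : E.GeomPoint) :
    galPoint σ (galPoint σ⁻¹ P) = P := by
  rw [← galPoint_mul, mul_inv_cancel, galPoint_one]

theorem galPoint_injective (σ : Gal(AlgebraicClosure K/K)) :
    Function.Injective (galPoint (E := E) σ) :=
  Function.LeftInverse.injective (galPoint_inv_apply σ)

theorem galPoint_some (σ : Gal(AlgebraicClosure K/K)) {x y : AlgebraicClosure K}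
    (h : (E⁄(AlgebraicClosure K)).Nonsingular x y) :
    ∃ h', galPoint σ (.some x y h) = .some (σ x) (σ y) h' := ⟨_, rfl⟩

theorem xCoord_galPoint (σ : Gal(AlgebraicClosure K/K)) (P : E.GeomPoint) :
    xCoord (galPoint σ P) = σ (xCoord P) := by
  rcases P with _ | _
  · exact (map_zero σ).symm
  · rfl

theorem eta_galPoint (σ : Gal(AlgebraicClosure K/K)) (P : E.GeomPoint) :
    eta (galPoint σ P) = σ (eta P) := by
  rcases P with _ | ⟨x, y, h⟩
  · exact (map_zero σ).symm
  · obtain ⟨h', e⟩ := galPoint_some σ h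
    have e1 : σ (E⁄(AlgebraicClosure K)).a₁ = (E⁄(AlgebraicClosure K)).a₁ := σ.commutes E.a₁
    have e3 : σ (E⁄(AlgebraicClosure K)).a₃ = (E⁄(AlgebraicClosure K)).a₃ := σ.commutes E.a₃
    rw [e, eta_some, eta_some, map_add, map_add, map_mul, map_mul, e1, e3, map_ofNat]

open scoped Classical in
/-- The conjugate `σ φ σ⁻¹` of an endomorphism of the group of geometric points. -/
def galConj (σ : Gal(AlgebraicClosure K/K)) (φ : AddMonoid.End E.GeomPoint) :
    AddMonoid.End E.GeomPoint :=
  galPoint σ * φ * galPoint σ⁻¹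

open scoped Classical in
theorem galConj_apply (σ : Gal(AlgebraicClosure K/K)) (φ : AddMonoid.End E.GeomPoint)
    (P : E.GeomPoint) : galConj σ φ P = galPoint σ (φ (galPoint σ⁻¹ P)) := rfl

open scoped Classical in
-- Apply σ to the coefficients of the defining polynomials. They are only claimed to lie in the
-- algebraic closure, since σ may move F.
theorem IsEndDefinedOver.galConj {F : IntermediateField K (AlgebraicClosure K)}
    {φ : AddMonoid.End E.GeomPoint} (h : IsEndDefinedOver F φ) (σ : Gal(AlgebraicClosure K/K)) :
    IsEndDefinedOver ⊤ (galConj σ φ) := by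
  rcases h with rfl | ⟨a, b, d, h⟩
  · left
    ext P
    rw [galConj_apply]
    exact congrArg _ (map_zero (galPoint σ))
  · right
    set f : F →+* (⊤ : IntermediateField K (AlgebraicClosure K)) :=
      ((IntermediateField.topEquiv (F := K) (E := AlgebraicClosure K)).symm : _ →+* _).comp
        ((σ : AlgebraicClosure K →+* AlgebraicClosure K).comp (algebraMap F _)) with hf
    have hfa : ∀ z : F, algebraMap (⊤ : IntermediateField K (AlgebraicClosure K)) _ (f z) =
        σ (algebraMap F _ z) := fun z => rfl
    have key : ∀ (q : MvPolynomial (Fin 2) F) x y,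
        MvPolynomial.aeval ![σ x, σ y] (q.map f) = σ (MvPolynomial.aeval ![x, y] q) := by
      intro q x y
      induction q using MvPolynomial.induction_on with
      | C a => simp only [MvPolynomial.map_C, MvPolynomial.aeval_C, hfa]
      | add p q hp hq => simp only [map_add, hp, hq]
      | mul_X p i hp =>
        simp only [map_mul, hp, MvPolynomial.map_X, MvPolynomial.aeval_X]
        fin_cases i <;> rfl
    refine ⟨a.map f, b.map f, d.map f, (h.image (galPoint σ)).subset fun P hP => ?_⟩
    refine ⟨galPoint σ⁻¹ P, fun hQ => hP ?_, galPoint_apply_inv σ P⟩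
    obtain ⟨x, y, h, h', e, hd, hφ⟩ := hQ
    have e' : P = galPoint σ (.some x y h) := by rw [← e, galPoint_apply_inv]
    obtain ⟨h2, e2⟩ := galPoint_some σ h
    obtain ⟨h3, e3⟩ := galPoint_some σ h'
    rw [e2] at e'
    have hh : (E⁄(AlgebraicClosure K)).Nonsingular
        (MvPolynomial.aeval ![σ x, σ y] (a.map f) / MvPolynomial.aeval ![σ x, σ y] (d.map f))
        (MvPolynomial.aeval ![σ x, σ y] (b.map f) / MvPolynomial.aeval ![σ x, σ y] (d.map f)) := by
      simpa only [key, map_div₀] using h3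
    refine ⟨σ x, σ y, h2, hh, e', ?_, ?_⟩
    · rw [key]
      exact (map_ne_zero σ).2 hd
    · rw [galConj_apply, hφ, e3]
      simp only [key, map_div₀]

open scoped Classical in
theorem hasRep_galConj {φ : AddMonoid.End E.GeomPoint}
    {X B : AlgebraicClosure K → AlgebraicClosure K} (h : HasRep φ X B)
    (σ : Gal(AlgebraicClosure K/K)) :
    HasRep (galConj σ φ) (fun x => σ (X (σ.symm x))) (fun x => σ (B (σ.symm x))) := by
  filter_upwards [(galPoint_injective σ⁻¹).tendsto_cofinite.eventually h] with P hP
  rw [galConj_apply, xCoord_galPoint, eta_galPoint, hP.2.1, hP.2.2, xCoord_galPoint,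
    eta_galPoint, map_mul]
  refine ⟨fun h0 => hP.1 (galPoint_injective σ (h0.trans (_root_.map_zero (galPoint σ)).symm)), rfl, ?_⟩
  congr 1
  exact σ.apply_symm_apply _

theorem isElliptic_baseChange [E.IsElliptic] : (E⁄(AlgebraicClosure K)).IsElliptic :=
  inferInstanceAs (E.map (algebraMap K (AlgebraicClosure K))).IsElliptic

open scoped Classical in
/-- An endomorphism of `E` with square `m` determines a square root of `m`, on which the Galois
group acts as it acts on the endomorphism. -/
theorem exists_sqrt_of_sq [CharZero K] [E.IsElliptic] {m : ℤ} (hm : m ≠ 0)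
    {F : IntermediateField K (AlgebraicClosure K)}
    {φ : AddMonoid.End E.GeomPoint} (hF : IsEndDefinedOver F φ) (hφ : ∀ P, φ (φ P) = m • P) :
    ∃ c : AlgebraicClosure K, c ^ 2 = m ∧ ∀ σ : Gal(AlgebraicClosure K/K),
      (galConj σ φ = φ → σ c = c) ∧ (galConj σ φ = -φ → σ c = -c) := by
  have := isElliptic_baseChange (E := E)
  rcases hF with rfl | ⟨a, b, d, hF⟩
  · exfalso
    obtain ⟨P, hP⟩ := (((tendsto_zsmul_cofinite (W := E⁄(AlgebraicClosure K)) hm)).eventually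
      eventually_ne_zero).exists
    exact hP (hφ P).symm
  obtain ⟨X, B, hX, hB, hr⟩ := Affine.Point.exists_hasRep hF
  obtain ⟨κ, β, hκ, hβ, hβ0, hc⟩ := hr.exists_hasLim_of_sq hm hφ hX hB
  -- Conjugation by σ replaces κ and β by their images. Negating φ keeps X, hence κ, and negates B,
  -- hence β.
  refine ⟨κ / β, hc, fun σ => ?_⟩
  have hrσ := hasRep_galConj hr σ
  have hκσ := hκ.conj (σ : AlgebraicClosure K ≃+* AlgebraicClosure K)
  have hβσ := hβ.conj (σ : AlgebraicClosure K ≃+* AlgebraicClosure K)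
  have hκ' : ∀ {X' : AlgebraicClosure K → AlgebraicClosure K},
      (∀ᶠ x in cofinite, σ (X (σ.symm x)) = X' x) →
        HasLimAtInfty (fun x => X' x / x) (σ κ) := by
    intro X' hX'
    refine hκσ.congr' ?_
    filter_upwards [hX'] with x hx
    rw [← hx]
    change _ = σ (X (σ.symm x) / σ.symm x)
    rw [map_div₀, σ.apply_symm_apply]
  constructor
  · intro h
    rw [h] at hrσ
    obtain ⟨e1, e2⟩ := hrσ.eventually_eq hr
    have h1 := (hκ' e1).unique hκ
    have h2 : σ β = β := hβσ.unique (hβ.congr' e2)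
    rw [map_div₀, h1, h2]
  · intro h
    rw [h] at hrσ
    obtain ⟨e1, e2⟩ := hrσ.eventually_eq hr.neg
    have h1 := (hκ' e1).unique hκ
    have h2 : σ β = -β := hβσ.unique (hβ.neg.congr' e2)
    rw [map_div₀, h1, h2, div_neg]

end WeierstrassCurve

end

/-! ### Dividing an endomorphism by p -/

section Descent

variable {A G : Type*} [AddCommGroup A] (p : ℕ) [Fact p.Prime]

/-- If an endomorphism `ψ` of a `p`-divisible group squares to a nonzero integer, then it can be
divided by a power of `p` so that the quotient does not vanish on the `p`-torsion. -/
theorem exists_endomorphism_ne_zero_on_torsion (hp : Function.Surjective fun a : A => p • a)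
    (hA : ∃ a : A, a ≠ 0 ∧ p • a = 0) (s : G → A →+ A) (ε : G → ℤˣ) (ψ : A →+ A) (m : ℤ)
    (hm : m ≠ 0) (hψ : ∀ a, ψ (ψ a) = m • a)
    (hε : ∀ g a, ψ (s g a) = (ε g : ℤ) • s g (ψ a)) :
    ∃ (ψ' : A →+ A) (m' : ℤ), (∀ a, ψ' (ψ' a) = m' • a) ∧
      (∀ g a, ψ' (s g a) = (ε g : ℤ) • s g (ψ' a)) ∧ ∃ a, p • a = 0 ∧ ψ' a ≠ 0 := by
  induction hn : m.natAbs using Nat.strong_induction_on generalizing m ψ with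
  | _ n ih =>
    by_cases h : ∃ a, p • a = 0 ∧ ψ a ≠ 0
    · exact ⟨ψ, m, hψ, hε, h⟩
    push Not at h
    -- As ψ kills the p-torsion, it factors through the surjection p.
    obtain ⟨ψ', hψ'⟩ : ∃ ψ' : A →+ A, ∀ a, ψ' (p • a) = ψ a := by
      refine ⟨(nsmulAddMonoidHom p).liftOfSurjective hp ⟨ψ, fun a ha => h a (by simpa using ha)⟩, fun a => ?_⟩
      exact AddMonoidHom.liftOfRightInverse_comp_apply _ _ _ _ a
    have hψ2 : ∀ a, p • ψ' a = ψ a := fun a => by rw [← map_nsmul, hψ']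
    have hsq : ∀ a, (p ^ 2) • ψ' (ψ' a) = m • a := fun a => by
      rw [← hψ a, pow_two, mul_smul, ← map_nsmul ψ', hψ2, hψ2]
    -- An element a of exact order p² is killed by m, because m·a = ψ'(ψ'(p²·a)).
    have hdvd : ((p ^ 2 : ℕ) : ℤ) ∣ m := by
      obtain ⟨t, ht0, ht⟩ := hA
      obtain ⟨a, rfl⟩ := hp t
      have ho : addOrderOf a = p ^ 2 := by
        refine addOrderOf_eq_prime_pow (p := p) (n := 1) (by simpa using ht0) ?_
        rw [pow_succ, pow_one, mul_smul]
        exact ht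
      rw [← ho, addOrderOf_dvd_iff_zsmul_eq_zero, ← hsq, ← map_nsmul, ← map_nsmul, ← ho,
        addOrderOf_nsmul_eq_zero, map_zero, map_zero]
    obtain ⟨m', rfl⟩ := hdvd
    have hp2 : Function.Surjective fun a : A => (p ^ 2) • a := by
      intro a
      obtain ⟨b, rfl⟩ := hp a
      obtain ⟨c, rfl⟩ := hp b
      exact ⟨c, by simp only [pow_two, mul_smul]⟩
    have hm' : m' ≠ 0 := right_ne_zero_of_mul hm
    refine ih m'.natAbs ?_ ψ' m' hm' ?_ ?_ rfl
    · rw [← hn, Int.natAbs_mul, Int.natAbs_natCast]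
      have h2 := (Fact.out : p.Prime).two_le
      have h3 := Int.natAbs_pos.2 hm'
      have h4 : 1 < p ^ 2 := by nlinarith
      exact (lt_mul_iff_one_lt_left h3).2 h4
    · intro a
      obtain ⟨b, rfl⟩ := hp2 a
      simp only
      rw [map_nsmul, map_nsmul, hsq, mul_smul, natCast_zsmul, smul_comm]
    · intro g a
      obtain ⟨b, rfl⟩ := hp a
      simp only
      rw [map_nsmul (s g), hψ', hψ', hε]

end Descent

/-! ### Operators on a non-split extension of characters that commute with the group up to sign -/

section Representations

variable {k G V W : Type*} [Field k] [Group G] [AddCommGroup V] [Module k V]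
  [AddCommGroup W] [Module k W]

/-- On a one-dimensional representation the group acts through scalars. -/
theorem Representation.exists_scalar (ρ : Representation k G V) (hV : Module.finrank k V = 1) :
    ∃ a : G →* k, ∀ g v, ρ g v = a g • v := by
  obtain ⟨t, ht0, ht⟩ := finrank_eq_one_iff'.1 hV
  have h : ∀ g, ∃ c : k, c • t = ρ g t := fun g => ht _
  choose a ha using h
  have hv : ∀ g v, ρ g v = a g • v := by
    intro g v
    obtain ⟨c, rfl⟩ := ht v
    rw [map_smul, ← ha, smul_comm]
  refine ⟨⟨⟨a, ?_⟩, ?_⟩, hv⟩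
  · apply smul_left_injective k ht0
    simp only
    rw [ha, map_one, one_smul]
    rfl
  · intro g h
    apply smul_left_injective k ht0
    simp only
    rw [ha, map_mul, Module.End.mul_apply, hv h, map_smul, hv g, smul_smul, mul_comm]

/-- One-dimensional representations with the same character are isomorphic. -/
theorem Representation.nonempty_equiv_of_scalar {ρ : Representation k G V}
    {σ : Representation k G W} (hV : Module.finrank k V = 1) (hW : Module.finrank k W = 1)
    {a : G → k} (hρ : ∀ g v, ρ g v = a g • v) (hσ : ∀ g w, σ g w = a g • w) :
    Nonempty (Representation.Equiv ρ σ) := by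
  have := Module.finite_of_finrank_eq_succ hV
  have := Module.finite_of_finrank_eq_succ hW
  refine ⟨.mk (LinearEquiv.ofFinrankEq V W (hV.trans hW.symm)) fun g => ?_⟩
  ext v
  simp only [LinearMap.comp_apply, LinearEquiv.coe_coe, hρ, hσ, map_smul]

variable {ρ : Representation k G V} {T : Subrepresentation ρ} {σ : Representation k G W}
  {D : V →ₗ[k] V} {ε : G → ℤˣ} {t : V} {a b : G → k}

/-- Let `V` be a non-split extension of `W` by a line `T`. An operator which commutes with the
group up to signs preserves `T`. -/
theorem IsNontrivialExtension.apply_mem (hE : IsNontrivialExtension ρ T σ)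
    (hW : Module.finrank k W = 1) (hD : ∀ g v, D (ρ g v) = (ε g : ℤ) • ρ g (D v))
    (hb : ∀ g w, σ g w = b g • w) (ha : ∀ g, ρ g t = a g • t) : D t ∈ T := by
  obtain ⟨π, hπ, hker, hns⟩ := hE
  by_contra hDt
  have hw0 : π (D t) ≠ 0 := fun h => hDt ((hker _).1 h)
  have hε : ∀ g, (ε g : ℤ) * (ε g : ℤ) = 1 := fun g => by
    rcases Int.units_eq_one_or (ε g) with h | h <;> simp [h]
  -- If D t lies outside T, it spans a stable line mapping isomorphically onto W. Its character εa
  -- must then be b, and the line gives a splitting.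
  have h1 : ∀ g, ρ g (D t) = ((ε g : ℤ) * a g : k) • D t := by
    intro g
    have h := hD g t
    rw [ha, map_smul] at h
    rw [mul_smul, h, ← Int.cast_smul_eq_zsmul k, smul_smul, ← Int.cast_mul, hε, Int.cast_one,
      one_smul]
  have h2 : ∀ g, ((ε g : ℤ) * a g : k) = b g := by
    intro g
    apply smul_left_injective k hw0
    simp only
    rw [← hb, ← map_smul, ← h1]
    exact LinearMap.congr_fun (π.isIntertwining' g) (D t)
  let B := FiniteDimensional.basisSingleton Unit hW (π (D t)) hw0
  let s : W →ₗ[k] V := B.constr k fun _ => D t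
  have hs : s (π (D t)) = D t := by
    have : B () = π (D t) := by simp [B]
    conv_lhs => rw [← this]
    simp only [s, Module.Basis.constr_basis]
  have hw : ∀ w, ∃ c : k, c • π (D t) = w := (finrank_eq_one_iff_of_nonzero' _ hw0).1 hW
  refine hns ⟨⟨s, fun g => ?_⟩, fun w => ?_⟩
  · ext w
    obtain ⟨c, rfl⟩ := hw w
    simp only [LinearMap.comp_apply, map_smul, hb, hs, h1, h2]
  · obtain ⟨c, rfl⟩ := hw w
    change π (s _) = _
    rw [map_smul, hs, map_smul]

/-- D acts on T by a scalar; at an element with sign -1 that scalar equals its own negative. -/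
theorem IsNontrivialExtension.apply_eq_zero [NeZero (2 : k)] (hE : IsNontrivialExtension ρ T σ)
    (hT : ∀ v ∈ T, ∃ c : k, c • t = v)
    (hW : Module.finrank k W = 1) (hD : ∀ g v, D (ρ g v) = (ε g : ℤ) • ρ g (D v))
    (hb : ∀ g w, σ g w = b g • w) (ha : ∀ g, ρ g t = a g • t) (hε : ∃ g, ε g = -1) : D t = 0 := by
  obtain ⟨c, hc⟩ := hT _ (hE.apply_mem hW hD hb ha)
  obtain ⟨g, hg⟩ := hε
  have h := hD g t
  rw [ha, map_smul, ← hc, map_smul, ha, hg, smul_comm] at h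
  have h3 : (2 : k) • (ρ g (D t)) = 0 := by
    rw [← hc, map_smul, ha, two_smul]
    conv_lhs => enter [1]; rw [h]
    simp
  have h4 : ρ g (D t) = 0 := (smul_eq_zero.1 h3).resolve_left two_ne_zero
  have h5 := congrArg (ρ g⁻¹) h4
  rwa [Representation.inv_self_apply, map_zero] at h5

/-- D kills T, so D² = μ forces μ = 0, and D induces a nonzero nilpotent operator. Its image
therefore lies in T, and it induces a nonzero map from W to T, equivariant wherever ε = 1. -/
theorem IsNontrivialExtension.scalar_eq_of_apply_ne_zero [NeZero (2 : k)]
    (hE : IsNontrivialExtension ρ T σ)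
    (ht : t ≠ 0) (hT : ∀ v ∈ T, ∃ c : k, c • t = v)
    (hW : Module.finrank k W = 1) (hD : ∀ g v, D (ρ g v) = (ε g : ℤ) • ρ g (D v))
    (hb : ∀ g w, σ g w = b g • w) (ha : ∀ g, ρ g t = a g • t) (hε : ∃ g, ε g = -1)
    {μ : k} (hμ : ∀ v, D (D v) = μ • v) (hD0 : ∃ v, D v ≠ 0) {g : G} (hg : ε g = 1) :
    a g = b g := by
  have hDt := hE.apply_eq_zero hT hW hD hb ha hε
  have hμ0 : μ = 0 := by
    have h := hμ t
    rw [hDt, map_zero] at h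
    exact (smul_eq_zero.1 h.symm).resolve_right ht
  obtain ⟨π, hπ, hker, -⟩ := hE
  have hDT : ∀ v ∈ T, D v = 0 := by
    intro v hv
    obtain ⟨c, rfl⟩ := hT v hv
    rw [map_smul, hDt, smul_zero]
  obtain ⟨v, hv⟩ := hD0
  have hπv : π v ≠ 0 := fun h => hv (hDT v ((hker v).1 h))
  obtain ⟨c, hc⟩ := (finrank_eq_one_iff_of_nonzero' _ hπv).1 hW (π (D v))
  have hDv : D v ∈ T := by
    have h1 := hDT (D v - c • v) ((hker _).1 (by rw [map_sub, map_smul, hc, sub_self]))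
    rw [map_sub, hμ, hμ0, zero_smul, zero_sub, map_smul, neg_eq_zero] at h1
    rw [← hker, ← hc, (smul_eq_zero.1 h1).resolve_right hv, zero_smul]
  have h1 := hDT (ρ g v - b g • v) ((hker _).1 (by
    rw [map_sub, map_smul, ← hb, sub_eq_zero]
    exact LinearMap.congr_fun (π.isIntertwining' g) v))
  rw [map_sub, map_smul, hD, hg, Units.val_one, one_smul, sub_eq_zero] at h1
  obtain ⟨d, hd⟩ := hT _ hDv
  rw [← hd, map_smul, ha, smul_comm] at h1
  exact smul_left_injective k (by rwa [hd]) h1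

end Representations

/-! ### The quadratic Gauss sum and the cyclotomic character -/

section GaussSum

variable {K : Type*} [Field K] [CharZero K] (p : ℕ) [Fact p.Prime]

/-- If `p ≡ 3 mod 4` and `√-p ∈ K`, then the mod `p` cyclotomic character of `K` takes values in
the squares. -/
theorem quadraticChar_modCyclotomicCharacter (hp : p % 4 = 3) (hK : IsSquare (-(p : K)))
    (g : Gal(AlgebraicClosure K/K)) :
    quadraticChar (ZMod p) (modCyclotomicCharacter p g : (ZMod p)ˣ) = 1 := by
  have hp2 : ringChar (ZMod p) ≠ 2 := by
    rw [ZMod.ringChar_zmod_n]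
    rintro rfl
    norm_num at hp
  have hp0 : p ≠ 0 := (Fact.out : p.Prime).ne_zero
  obtain ⟨ζ, hζ⟩ := HasEnoughRootsOfUnity.exists_primitiveRoot (AlgebraicClosure K) p
  set ψ := AddChar.zmodChar p ((IsPrimitiveRoot.iff_def ζ p).mp hζ).left with hψ
  have hψp : ψ.IsPrimitive := AddChar.zmodChar_primitive_of_primitive_root p hζ
  set χ := (quadraticChar (ZMod p)).ringHomComp (Int.castRingHom (AlgebraicClosure K)) with hχ
  have hinj : Function.Injective (Int.castRingHom (AlgebraicClosure K)) := Int.cast_injective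
  have hχ1 : χ ≠ 1 := (MulChar.ringHomComp_ne_one_iff hinj).2 (quadraticChar_ne_one hp2)
  have hχ2 : χ.IsQuadratic := (quadraticChar_isQuadratic (ZMod p)).comp _
  have hχa : ∀ a, χ a = ((quadraticChar (ZMod p) a : ℤ) : AlgebraicClosure K) := fun a => rfl
  have hsq := gaussSum_sq hχ1 hχ2 hψp
  rw [hχa, quadraticChar_neg_one hp2, ZMod.card, ZMod.χ₄_nat_three_mod_four hp] at hsq
  obtain ⟨s, hs⟩ := hK
  -- For p ≡ 3 mod 4 the Gauss sum squares to -p, so it is ± the given root in K.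
  have hfix : g (gaussSum χ ψ) = gaussSum χ ψ := by
    have h1 : gaussSum χ ψ ^ 2 = (algebraMap K (AlgebraicClosure K) s) ^ 2 := by
      rw [hsq, pow_two, ← map_mul, ← hs]
      simp
    rcases sq_eq_sq_iff_eq_or_eq_neg.1 h1 with h | h <;> rw [h]
    · exact g.commutes s
    · rw [map_neg, g.commutes s]
  have h0 : gaussSum χ ψ ≠ 0 := by
    refine gaussSum_ne_zero_of_nontrivial ?_ hχ1 hψp
    rw [ZMod.card]
    exact Nat.cast_ne_zero.2 hp0
  -- Galois fixes the integer values of χ and raises the p-th roots of unity to the power given by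
  -- the cyclotomic character.
  have hshift : g (gaussSum χ ψ) =
      gaussSum χ (ψ.mulShift (modCyclotomicCharacter p g : (ZMod p)ˣ)) := by
    rw [gaussSum, gaussSum, map_sum]
    refine Finset.sum_congr rfl fun a _ => ?_
    rw [map_mul, hχa, map_intCast, AddChar.mulShift_apply]
    congr 1
    have hu : IsUnit (ψ a) := ψ.val_isUnit a
    have hmem : hu.unit ∈ rootsOfUnity p (AlgebraicClosure K) := by
      rw [mem_rootsOfUnity', IsUnit.unit_spec, ← AddChar.map_nsmul_eq_pow]
      simp
    have h2 := modularCyclotomicCharacter.spec (AlgebraicClosure K)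
      (natCard_rootsOfUnity_algebraicClosure (K := K) p)
      (g : AlgebraicClosure K ≃+* AlgebraicClosure K) hmem
    rw [IsUnit.unit_spec] at h2
    refine h2.trans ?_
    rw [← AddChar.map_nsmul_eq_pow, nsmul_eq_mul, ZMod.natCast_zmod_val]
    rfl
  have h3 := gaussSum_mulShift χ ψ (modCyclotomicCharacter p g)
  rw [← hshift, hfix] at h3
  have h4 : χ (modCyclotomicCharacter p g : (ZMod p)ˣ) = 1 :=
    mul_right_cancel₀ h0 (h3.trans (one_mul _).symm)
  rw [hχa] at h4
  exact_mod_cast h4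

theorem quadraticChar_neg_sq (hp : p % 4 = 3) {a : ZMod p} (ha : a ≠ 0) :
    quadraticChar (ZMod p) (-a ^ 2) = -1 := by
  have hp2 : ringChar (ZMod p) ≠ 2 := by
    rw [ZMod.ringChar_zmod_n]
    rintro rfl
    norm_num at hp
  rw [neg_eq_neg_one_mul, map_mul, quadraticChar_sq_one' ha, quadraticChar_neg_one hp2, ZMod.card,
    ZMod.χ₄_nat_three_mod_four hp, mul_one]

end GaussSum

/-! ### Trace-zero elements, conductors and the field generated by an order -/

section QuadraticOrders

variable {L : Type*} [Field L]

/-- The index annihilates the quotient group; for infinite index it is 0 by convention and the claim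
is trivial. -/
theorem orderConductor_mul_mem (O : Subring L) (x : 𝓞 L) : (orderConductor O : L) * x ∈ O := by
  have h := AddSubgroup.nsmul_index_mem
    (O.toAddSubgroup.addSubgroupOf (algebraMap (𝓞 L) L).range.toAddSubgroup)
    (⟨algebraMap (𝓞 L) L x, ⟨x, rfl⟩⟩ : (algebraMap (𝓞 L) L).range.toAddSubgroup)
  rw [AddSubgroup.mem_addSubgroupOf] at h
  rw [← nsmul_eq_mul]
  exact h

variable [NumberField L]

open Algebra in
/-- The square of the trace-zero element `2y - tr y` of a free quadratic algebra is the
discriminant of `(1, y)`. -/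
theorem sq_two_mul_sub_trace {S : Type*} [CommRing S] (b : Module.Basis (Fin 2) ℤ S) (y : S) :
    (2 * y - algebraMap ℤ S (trace ℤ S y)) ^ 2 =
      algebraMap ℤ S (2 * trace ℤ S (y * y) - trace ℤ S y ^ 2) := by
  apply leftMulMatrix_injective b
  have ht : ∀ z, trace ℤ S z = (leftMulMatrix b z).trace := trace_eq_matrix_trace b
  have halg : ∀ r : ℤ, algebraMap ℤ (Matrix (Fin 2) (Fin 2) ℤ) r = !![r, 0; 0, r] := by
    intro r
    ext i j
    fin_cases i <;> fin_cases j <;> simp [Matrix.intCast_apply]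
  have htwo : (2 : Matrix (Fin 2) (Fin 2) ℤ) = !![2, 0; 0, 2] := by
    rw [← halg]
    simp
  rw [map_pow, map_sub, map_mul, map_ofNat, AlgHom.commutes, AlgHom.commutes, ht, ht, map_mul, halg,
    halg, htwo]
  generalize leftMulMatrix b y = M
  rw [Matrix.eta_fin_two M, pow_two]
  ext i j
  fin_cases i <;> fin_cases j <;>
    simp [Matrix.mul_apply, Fin.sum_univ_two, Matrix.trace_fin_two] <;> ring

open Algebra in
theorem exists_sq_eq_int_of_forall_mul_mem [IsQuadraticExtension ℚ L] {O : Subring L} {N : ℕ} (hN : N ≠ 0)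
    (h : ∀ x : 𝓞 L, (N : L) * x ∈ O) {p : ℕ} (hp : p.Prime) (hp2 : p ≠ 2) :
    ∃ (δ : O) (m : ℤ), m ≠ 0 ∧ (δ : L) ^ 2 = m ∧ (∀ q : ℚ, (δ : L) ≠ algebraMap ℚ L q) ∧
      ((p : ℤ) ∣ m → (p : ℤ) ∣ (N : ℤ) ^ 2 * NumberField.discr L) := by
  have hr : Module.finrank ℤ (𝓞 L) = 2 := by
    rw [NumberField.RingOfIntegers.rank, IsQuadraticExtension.finrank_eq_two]
  let b : Module.Basis (Fin 2) ℤ (𝓞 L) := Module.finBasisOfFinrankEq ℤ (𝓞 L) hr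
  have hd : NumberField.discr L = trace ℤ (𝓞 L) (b 0 * b 0) * trace ℤ (𝓞 L) (b 1 * b 1) -
      trace ℤ (𝓞 L) (b 0 * b 1) * trace ℤ (𝓞 L) (b 0 * b 1) := by
    rw [← NumberField.discr_eq_discr L b, discr_def, Matrix.det_fin_two]
    simp only [traceMatrix_apply, traceForm_apply, mul_comm (b 1) (b 0)]
  have hone : (1 : 𝓞 L) = b.repr 1 0 • b 0 + b.repr 1 1 • b 1 := by
    conv_lhs => rw [← b.sum_repr 1, Fin.sum_univ_two]
  set u := b.repr 1 0
  set v := b.repr 1 1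
  have htr1 : trace ℤ (𝓞 L) 1 = 2 := by
    rw [trace_eq_matrix_trace b, map_one, Matrix.trace_one]
    simp
  -- With 1 = u b₀ + v b₁, the discriminant of (1, b₁) is u²d_L and that of (1, b₀) is v²d_L. Taking
  -- traces, 2 = u tr b₀ + v tr b₁, so the odd prime p cannot divide both u and v.
  have key : ∃ (y : 𝓞 L) (w : ℤ), ¬ (p : ℤ) ∣ w ∧
      2 * trace ℤ (𝓞 L) (y * y) - trace ℤ (𝓞 L) y ^ 2 = w ^ 2 * NumberField.discr L := by
    have e0 : trace ℤ (𝓞 L) (b 0) = u * trace ℤ (𝓞 L) (b 0 * b 0) +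
        v * trace ℤ (𝓞 L) (b 0 * b 1) := by
      conv_lhs => rw [← one_mul (b 0), hone]
      simp only [add_mul, smul_mul_assoc, map_add, map_smul, smul_eq_mul, mul_comm (b 1) (b 0)]
    have e1 : trace ℤ (𝓞 L) (b 1) = u * trace ℤ (𝓞 L) (b 0 * b 1) +
        v * trace ℤ (𝓞 L) (b 1 * b 1) := by
      conv_lhs => rw [← one_mul (b 1), hone]
      simp only [add_mul, smul_mul_assoc, map_add, map_smul, smul_eq_mul]
    have e2 : 2 = u * trace ℤ (𝓞 L) (b 0) + v * trace ℤ (𝓞 L) (b 1) := by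
      rw [← htr1]
      conv_lhs => rw [hone]
      simp only [map_add, map_smul, smul_eq_mul]
    by_cases hu : (p : ℤ) ∣ u
    · have hv : ¬ (p : ℤ) ∣ v := by
        intro hv
        have : (p : ℤ) ∣ (2 : ℕ) := by
          push_cast
          rw [e2]
          exact dvd_add (Dvd.dvd.mul_right hu _) (Dvd.dvd.mul_right hv _)
        exact hp2 ((Nat.prime_dvd_prime_iff_eq hp Nat.prime_two).1 (Int.natCast_dvd_natCast.1 this))
      refine ⟨b 0, v, hv, ?_⟩
      rw [hd, e2, e1, e0]
      ring
    · refine ⟨b 1, u, hu, ?_⟩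
      rw [hd, e2, e1, e0]
      ring
  obtain ⟨y, w, hw, hyw⟩ := key
  set z : 𝓞 L := 2 * y - algebraMap ℤ (𝓞 L) (trace ℤ (𝓞 L) y) with hz
  have hzsq : z ^ 2 = algebraMap ℤ (𝓞 L) (w ^ 2 * NumberField.discr L) := by
    rw [hz, sq_two_mul_sub_trace b, hyw]
  have hztr : trace ℤ (𝓞 L) z = 0 := by
    rw [hz, map_sub, two_mul, map_add, Algebra.algebraMap_eq_smul_one, map_smul, htr1, smul_eq_mul]
    ring
  have hm : (N : ℤ) ^ 2 * (w ^ 2 * NumberField.discr L) ≠ 0 := by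
    refine mul_ne_zero (pow_ne_zero _ (by exact_mod_cast hN)) (mul_ne_zero (pow_ne_zero _ ?_)
      (NumberField.discr_ne_zero L))
    rintro rfl
    exact hw (dvd_zero _)
  have hδ : ((N : L) * z) ^ 2 = (((N : ℤ) ^ 2 * (w ^ 2 * NumberField.discr L) : ℤ) : L) := by
    have h2 := congrArg (algebraMap (𝓞 L) L) hzsq
    rw [map_pow] at h2
    rw [mul_pow]
    refine (congrArg _ h2).trans ?_
    simp
  refine ⟨⟨(N : L) * z, h z⟩, (N : ℤ) ^ 2 * (w ^ 2 * NumberField.discr L), hm, hδ, ?_, ?_⟩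
  · intro q hq
    have h1 : trace ℚ L ((N : L) * z) = 0 := by
      have h2 := Algebra.coe_trace_int z
      rw [hztr] at h2
      rw [← nsmul_eq_mul, map_nsmul, ← h2]
      simp
    simp only at hq
    rw [hq, trace_algebraMap, IsQuadraticExtension.finrank_eq_two] at h1
    have hq0 : q = 0 := by simpa using h1
    rw [hq, hq0, map_zero, zero_pow two_ne_zero] at hδ
    exact hm (by exact_mod_cast hδ.symm)
  · intro hpm
    have hpp : Prime (p : ℤ) := Nat.prime_iff_prime_int.1 hp
    rcases hpp.dvd_or_dvd hpm with h1 | h1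
    · exact h1.mul_right _
    · rcases hpp.dvd_or_dvd h1 with h2 | h2
      · exact (hw (hpp.dvd_of_dvd_pow h2)).elim
      · exact h2.mul_left _

theorem IsOrderIn.exists_mul_mem {O : Subring L} (hO : IsOrderIn O) :
    ∃ N : ℕ, N ≠ 0 ∧ ∀ x : 𝓞 L, (N : L) * x ∈ O := by
  have h1 : ∀ x : L, ∃ N : ℕ, N ≠ 0 ∧ (N : L) * x ∈ O := by
    intro x
    have hx : x ∈ Submodule.span ℚ (O : Set L) := by rw [hO.2]; trivial
    induction hx using Submodule.span_induction with
    | mem x h => exact ⟨1, one_ne_zero, by simpa using h⟩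
    | zero => exact ⟨1, one_ne_zero, by simp⟩
    | add x y _ _ hx hy =>
      obtain ⟨M, hM, hx⟩ := hx
      obtain ⟨N, hN, hy⟩ := hy
      refine ⟨M * N, mul_ne_zero hM hN, ?_⟩
      have : ((M * N : ℕ) : L) * (x + y) = N * (M * x) + M * (N * y) := by push_cast; ring
      rw [this]
      exact O.add_mem (O.mul_mem (natCast_mem O N) hx) (O.mul_mem (natCast_mem O M) hy)
    | smul a x _ hx =>
      obtain ⟨M, hM, hx⟩ := hx
      refine ⟨a.den * M, mul_ne_zero a.den_nz hM, ?_⟩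
      have : ((a.den * M : ℕ) : L) * (a • x) = a.num * (M * x) := by
        have h2 : (a.den : L) * (a : L) = a.num := by
          exact_mod_cast congrArg (Rat.cast : ℚ → L) (Rat.den_mul_eq_num a)
        rw [Rat.smul_def, ← h2]
        push_cast
        ring
      rw [this]
      exact O.mul_mem (intCast_mem O a.num) hx
  choose f hf0 hf using h1
  let b := NumberField.RingOfIntegers.basis L
  refine ⟨∏ i, f (b i), Finset.prod_ne_zero_iff.2 fun i _ => hf0 _, fun x => ?_⟩
  change _ * algebraMap (𝓞 L) L x ∈ O
  rw [← b.sum_repr x, map_sum, Finset.mul_sum]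
  refine O.sum_mem fun i _ => ?_
  have h2 : (f (b i) : L) * (b i : L) ∈ O := hf _
  obtain ⟨c, hc⟩ := Finset.dvd_prod_of_mem (fun i => f (b i)) (Finset.mem_univ i)
  rw [hc, map_zsmul, zsmul_eq_mul]
  have : ((f (b i) * c : ℕ) : L) * ((b.repr x i : ℤ) * algebraMap (𝓞 L) L (b i)) =
      (c : L) * (b.repr x i : ℤ) * (f (b i) * (b i : L)) := by push_cast; ring
  rw [this]
  exact O.mul_mem (O.mul_mem (natCast_mem O c) (intCast_mem O _)) h2

theorem exists_eq_add_mul_of_notMem_range [Algebra.IsQuadraticExtension ℚ L] {δ : L} (hδ : ∀ q : ℚ, δ ≠ algebraMap ℚ L q) (x : L) :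
    ∃ r s : ℚ, x = algebraMap ℚ L r + algebraMap ℚ L s * δ := by
  have hli : LinearIndependent ℚ ![1, δ] := by
    rw [LinearIndependent.pair_iff]
    intro s t hst
    rw [Algebra.smul_def, Algebra.smul_def, mul_one] at hst
    have ht : t = 0 := by
      by_contra ht
      refine hδ (-s / t) ?_
      have ht' : algebraMap ℚ L t ≠ 0 := by simpa using ht
      rw [map_div₀, map_neg, eq_div_iff ht']
      linear_combination hst
    subst ht
    exact ⟨by simpa using hst, rfl⟩
  have hs := hli.span_eq_top_of_card_eq_finrank' (by
    rw [Algebra.IsQuadraticExtension.finrank_eq_two]; simp)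
  have hx : x ∈ Submodule.span ℚ (Set.range ![1, δ]) := by rw [hs]; trivial
  rw [Matrix.range_cons_cons_empty, Submodule.mem_span_pair] at hx
  obtain ⟨r, s, h⟩ := hx
  exact ⟨r, s, by rw [← h, Algebra.smul_def, Algebra.smul_def, mul_one]⟩

/-- L = ℚ(δ), so fixing the image of δ fixes the image of L. -/
theorem mem_fixingSubgroup_compositum_iff [Algebra.IsQuadraticExtension ℚ L] {K : Type*} [Field K] (j : L →+* AlgebraicClosure K)
    {δ : L} (hδ : ∀ q : ℚ, δ ≠ algebraMap ℚ L q) (g : Gal(AlgebraicClosure K/K)) :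
    g ∈ (compositum K j).fixingSubgroup ↔ g (j δ) = j δ := by
  rw [IntermediateField.mem_fixingSubgroup_iff]
  constructor
  · intro h
    exact h _ (IntermediateField.subset_adjoin _ _ ⟨δ, rfl⟩)
  · intro h
    have hle : compositum K j ≤ IntermediateField.fixedField (Subgroup.zpowers g) := by
      rw [compositum, IntermediateField.adjoin_le_iff]
      rintro _ ⟨x, rfl⟩ ⟨τ, n, rfl⟩
      have hg : g (j x) = j x := by
        obtain ⟨r, s, rfl⟩ := exists_eq_add_mul_of_notMem_range hδ x
        simp [h]
      have hz : g ∈ MulAction.stabilizer Gal(AlgebraicClosure K/K) (j x) := hg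
      exact (MulAction.stabilizer _ (j x)).zpow_mem hz n
    intro x hx
    exact hle hx ⟨g, Subgroup.mem_zpowers g⟩

end QuadraticOrders

/-- An infinite relative index is recorded as 0, so the content is finiteness: the quotient is
finitely generated and torsion. -/
theorem IsOrderIn.orderConductor_ne_zero {L : Type*} [Field L] [NumberField L] {O : Subring L}
    (hO : IsOrderIn O) : orderConductor O ≠ 0 := by
  obtain ⟨N, hN, hmem⟩ := hO.exists_mul_mem
  let f : 𝓞 L →+ (algebraMap (𝓞 L) L).range.toAddSubgroup :=
    (algebraMap (𝓞 L) L).rangeRestrict.toAddMonoidHom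
  have hf : Function.Surjective f := (algebraMap (𝓞 L) L).rangeRestrict_surjective
  let H := O.toAddSubgroup.addSubgroupOf (algebraMap (𝓞 L) L).range.toAddSubgroup
  let q : 𝓞 L →+ _ ⧸ H := (QuotientAddGroup.mk' H).comp f
  have hq : Function.Surjective q := (QuotientAddGroup.mk'_surjective H).comp hf
  have : AddGroup.FG (𝓞 L) := AddGroup.fg_iff_addMonoid_fg.2
    (Module.Finite.iff_addMonoid_fg.1 inferInstance)
  have : AddGroup.FG (_ ⧸ H) := AddGroup.fg_of_surjective hq
  have htor : IsAddTorsion (_ ⧸ H) := by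
    intro y
    obtain ⟨x, rfl⟩ := hq y
    refine isOfFinAddOrder_iff_nsmul_eq_zero.2 ⟨N, Nat.pos_of_ne_zero hN, ?_⟩
    rw [← map_nsmul]
    refine (QuotientAddGroup.eq_zero_iff _).2 ?_
    rw [AddSubgroup.mem_addSubgroupOf]
    change algebraMap (𝓞 L) L (N • x) ∈ O
    rw [map_nsmul, nsmul_eq_mul]
    exact hmem x
  have : Finite (_ ⧸ H) := AddCommGroup.finite_of_fg_isAddTorsion _ htor
  exact AddSubgroup.index_ne_zero_of_finite

/-! ### The endomorphism δ on torsion points, and the final argument -/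

noncomputable section

namespace WeierstrassCurve

variable {K : Type*} [Field K] {E : WeierstrassCurve K}

open scoped Classical in
/-- The linear map induced by an endomorphism on the `n`-torsion. -/
def torsionMap (n : ℕ) (ψ : E.GeomPoint →+ E.GeomPoint) : E.Torsion n →ₗ[ZMod n] E.Torsion n :=
  AddMonoidHom.toZModLinearMap n ((ψ.comp (E.Torsion n).subtype).codRestrict (E.Torsion n)
    (fun P => by
      rw [AddSubgroup.torsionBy.nsmul_iff, ← map_nsmul, AddSubgroup.torsionBy.nsmul, map_zero]))

open scoped Classical in
theorem torsionMap_torsionRep {n : ℕ} {ψ : E.GeomPoint →+ E.GeomPoint}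
    {ε : Gal(AlgebraicClosure K/K) → ℤˣ}
    (h : ∀ g P, ψ (galPoint g P) = (ε g : ℤ) • galPoint g (ψ P)) (g : Gal(AlgebraicClosure K/K))
    (P : E.Torsion n) :
    torsionMap n ψ (E.torsionRep n g P) = (ε g : ℤ) • E.torsionRep n g (torsionMap n ψ P) :=
  Subtype.ext (h g P)

open scoped Classical in
theorem torsionMap_torsionMap {n : ℕ} {ψ : E.GeomPoint →+ E.GeomPoint} {m : ℤ}
    (h : ∀ P, ψ (ψ P) = m • P) (P : E.Torsion n) :
    torsionMap n ψ (torsionMap n ψ P) = (m : ZMod n) • P := by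
  rw [Int.cast_smul_eq_zsmul]
  exact Subtype.ext (h P)

open scoped Classical in
/-- Let `φ` be an element with square `m` of the endomorphism ring. The Galois group commutes with
`φ` up to the sign by which it acts on a square root of `m`. -/
theorem HasCMOver.exists_endomorphism [CharZero K] [E.IsElliptic] {L : Type*} [Field L]
    {O : Subring L} {F : IntermediateField K (AlgebraicClosure K)} (h : E.HasCMOver O F)
    (j : L →+* AlgebraicClosure K) {δ : O} {m : ℤ} (hm : m ≠ 0) (hδ : (δ : L) ^ 2 = m) :
    ∃ (φ : E.GeomPoint →+ E.GeomPoint) (ε : Gal(AlgebraicClosure K/K) → ℤˣ),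
      (∀ P, φ (φ P) = m • P) ∧ (∀ g P, φ (galPoint g P) = (ε g : ℤ) • galPoint g (φ P)) ∧
      ∀ g, ε g = 1 ↔ g (j δ) = j δ := by
  obtain ⟨⟨ι, hinj, hι⟩, hF⟩ := h
  have hδO : δ ^ 2 = (m : O) := Subtype.ext (by simpa using hδ)
  have hmem : ∀ x : O, IsEndDefinedOver F (ι x) := fun x =>
    hι.subset (Set.mem_range_self x)
  have hsq : ∀ P, ι δ (ι δ P) = m • P := by
    intro P
    have h1 := congrArg ι hδO
    rw [pow_two, map_mul, map_intCast] at h1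
    exact DFunLike.congr_fun h1 P
  obtain ⟨c, hc, hg⟩ := exists_sqrt_of_sq hm (hmem δ) hsq
  have hj0 : j δ ≠ 0 := by
    intro h0
    rw [(map_eq_zero j).1 h0, zero_pow two_ne_zero] at hδ
    have h2 := congrArg j hδ
    rw [map_zero, map_intCast] at h2
    exact hm (by exact_mod_cast h2.symm)
  -- Which root occurs is immaterial: Galois acts on both by the same sign.
  have hjc : c = j δ ∨ c = -j δ := by
    rw [← sq_eq_sq_iff_eq_or_eq_neg, hc, ← map_pow, hδ, map_intCast]
  -- The conjugate is again an element of O with square δ², and O is a domain.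
  have hconj : ∀ g, galConj g (ι δ) = ι δ ∨ galConj g (ι δ) = -ι δ := by
    intro g
    obtain ⟨x, hx⟩ := hι.superset (hF _ ((hmem δ).galConj g))
    have hx2 : x ^ 2 = δ ^ 2 := by
      have h3 : ι (x ^ 2) = ι (δ ^ 2) := by
        rw [hδO, map_intCast, pow_two, map_mul, hx]
        ext1 P
        change galConj g (ι δ) (galConj g (ι δ) P) = m • P
        rw [galConj_apply, galConj_apply, galPoint_inv_apply, hsq, map_zsmul, galPoint_apply_inv]
      exact hinj h3
    rcases sq_eq_sq_iff_eq_or_eq_neg.1 hx2 with rfl | rfl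
    · exact .inl hx.symm
    · exact .inr (by rw [← hx, map_neg])
  have hcg : ∀ (g : Gal(AlgebraicClosure K/K)) (s : AlgebraicClosure K),
      g c = s * c → g (j δ) = s * j δ := by
    intro g s h1
    rcases hjc with rfl | rfl
    · exact h1
    · rw [map_neg, mul_neg, neg_inj] at h1
      exact h1
  have hmul : ∀ g P, ι δ (galPoint g P) = galPoint g (ι δ P) ∧ g (j δ) = j δ ∨
      ι δ (galPoint g P) = -galPoint g (ι δ P) ∧ g (j δ) ≠ j δ := by
    intro g P
    have h1 : galConj g (ι δ) (galPoint g P) = galPoint g (ι δ P) := by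
      rw [galConj_apply, galPoint_inv_apply]
    rcases hconj g with h2 | h2
    · left
      rw [← h1, h2]
      refine ⟨rfl, ?_⟩
      simpa using hcg g 1 (by rw [(hg g).1 h2, one_mul])
    · right
      rw [← h1, h2]
      refine ⟨(neg_neg _).symm, ?_⟩
      have := hcg g (-1) (by rw [(hg g).2 h2, neg_one_mul])
      rw [this, neg_one_mul]
      exact fun h => hj0 (self_eq_neg.1 h.symm)
  obtain ⟨ε, hε⟩ : ∃ ε : Gal(AlgebraicClosure K/K) → ℤˣ,
      ∀ g, ε g = if g (j δ) = j δ then 1 else -1 := ⟨_, fun _ => rfl⟩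
  refine ⟨ι δ, ε, hsq, fun g P => ?_, fun g => ?_⟩
  · rcases hmul g P with ⟨h1, h2⟩ | ⟨h1, h2⟩
    · have h3 : ε g = 1 := (hε g).trans (if_pos h2)
      rw [h3, Units.val_one, one_smul]
      exact h1
    · have h3 : ε g = -1 := (hε g).trans (if_neg h2)
      rw [h3, Units.val_neg, Units.val_one, neg_one_smul]
      exact h1
  · rw [hε g]
    split_ifs with h1 <;> simp [h1]

end WeierstrassCurve

theorem finrank_dual_eq_one {k V : Type*} [Field k] [AddCommGroup V] [Module k V]
    (hV : Module.finrank k V = 1) : Module.finrank k (Module.Dual k V) = 1 := by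
  have := Module.finite_of_finrank_eq_succ hV
  rw [Subspace.dual_finrank_eq, hV]

theorem dualTwist_apply_of_scalar {K : Type*} [Field K] [CharZero K] {p : ℕ} [Fact p.Prime]
    {V : Type*} [AddCommGroup V] [Module (ZMod p) V]
    {ρ : Representation (ZMod p) Gal(AlgebraicClosure K/K) V}
    {a : Gal(AlgebraicClosure K/K) →* ZMod p} (ha : ∀ g v, ρ g v = a g • v)
    (g : Gal(AlgebraicClosure K/K)) (f : Module.Dual (ZMod p) V) :
    dualTwist ρ g f = ((modCyclotomicCharacter p g : (ZMod p)ˣ) * a g⁻¹ : ZMod p) • f := by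
  ext v
  change ((modCyclotomicCharacter p g : (ZMod p)ˣ) : ZMod p) • f (ρ g⁻¹ v) = _
  rw [ha, map_smul, smul_smul]
  rfl

open WeierstrassCurve in
open scoped Classical in
theorem galois_structure_of_sq_eq_int {K : Type*} [Field K] [CharZero K]
    {L : Type*} [Field L] [NumberField L] [Algebra.IsQuadraticExtension ℚ L]
    (j : L →+* AlgebraicClosure K) (O : Subring L)
    (p : ℕ) [Fact p.Prime] (hp : p ≠ 2) (E : WeierstrassCurve K) [E.IsElliptic]
    (hKL : compositum K j ≠ ⊥) (hCM : E.HasCMOver O (compositum K j))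
    (T : Subrepresentation (E.torsionRep p))
    (hT : Module.finrank (ZMod p) T.toSubmodule = 1)
    (hT' : ¬ Nonempty (Representation.Equiv T.toRepresentation (dualTwist T.toRepresentation)))
    (hE : IsNontrivialExtension (E.torsionRep p) T (dualTwist T.toRepresentation))
    {δ : O} {m : ℤ} (hm : m ≠ 0) (hδ : (δ : L) ^ 2 = m)
    (hδQ : ∀ q : ℚ, (δ : L) ≠ algebraMap ℚ L q) :
    (p : ℤ) ∣ m ∧
      IsIsomorphicOn (compositum K j).fixingSubgroup T.toRepresentation
        (dualTwist T.toRepresentation) ∧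
      ¬ (p % 4 = 3 ∧ IsSquare (-(p : K))) := by
  have := isElliptic_baseChange (E := E)
  have h2 : NeZero (2 : ZMod p) := ⟨by
    rw [show (2 : ZMod p) = ((2 : ℕ) : ZMod p) by simp, Ne, ZMod.natCast_eq_zero_iff,
      Nat.prime_dvd_prime_iff_eq Fact.out Nat.prime_two]
    exact hp⟩
  obtain ⟨φ, ε, hφ, hφε, hεj⟩ := hCM.exists_endomorphism j hm hδ
  have hfix : ∀ g, g ∈ (compositum K j).fixingSubgroup ↔ ε g = 1 := fun g =>
    (mem_fixingSubgroup_compositum_iff j hδQ g).trans (hεj g).symm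
  have hε1 : ∀ g, ε g ≠ 1 → ε g = -1 := fun g => (Int.units_eq_one_or (ε g)).resolve_left
  -- If every sign were +1, the whole Galois group would fix KL, so KL = K.
  have hεex : ∃ g, ε g = -1 := by
    by_contra hno
    push Not at hno
    apply hKL
    have htop : (compositum K j).fixingSubgroup = ⊤ := by
      rw [eq_top_iff]
      intro g _
      rw [hfix]
      by_contra h
      exact hno g (hε1 g h)
    have : IsGalois K (AlgebraicClosure K) := inferInstance
    rw [← InfiniteGalois.fixedField_fixingSubgroup (compositum K j), htop]
    exact InfiniteGalois.fixedField_bot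
  obtain ⟨a, ha⟩ := T.toRepresentation.exists_scalar hT
  have hW := finrank_dual_eq_one hT
  have hb := dualTwist_apply_of_scalar ha
  obtain ⟨t, ht0, ht⟩ := finrank_eq_one_iff'.1 hT
  have ht0' : (t : E.Torsion p) ≠ 0 := fun h => ht0 (Subtype.ext h)
  have hTt : ∀ v ∈ T, ∃ c : ZMod p, c • (t : E.Torsion p) = v := by
    intro v hv
    obtain ⟨c, hc⟩ := ht ⟨v, hv⟩
    exact ⟨c, congrArg Subtype.val hc⟩
  have hat : ∀ g, E.torsionRep p g (t : E.Torsion p) = a g • (t : E.Torsion p) := fun g =>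
    congrArg Subtype.val (ha g t)
  have hm0 : (m : ZMod p) = 0 := by
    have h1 := hE.apply_eq_zero (D := torsionMap p φ) hTt hW (torsionMap_torsionRep hφε) hb hat hεex
    have h3 := torsionMap_torsionMap hφ (t : E.Torsion p)
    rw [h1, map_zero] at h3
    exact (smul_eq_zero.1 h3.symm).resolve_right ht0'
  -- φ may vanish on E[p], so a quotient of it by a power of p is used. Only its additivity, its
  -- integral square and its signs under Galois are needed.
  have hscal : ∀ g, ε g = 1 → a g = (modCyclotomicCharacter p g : (ZMod p)ˣ) * a g⁻¹ := by
    obtain ⟨ψ, m', hψ, hψε, P, hP, hψP⟩ := exists_endomorphism_ne_zero_on_torsion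
      (A := E.GeomPoint) p
      (Affine.Point.nsmul_surjective (W := E⁄(AlgebraicClosure K))
        (Fact.out : p.Prime).ne_zero)
      ⟨t.1.1, fun h => ht0' (Subtype.ext h), congrArg Subtype.val (AddSubgroup.torsionBy.nsmul t.1)⟩
      galPoint ε φ m hm hφ hφε
    intro g hg
    refine hE.scalar_eq_of_apply_ne_zero (D := torsionMap p ψ) ht0' hTt hW
      (torsionMap_torsionRep hψε) hb hat hεex (torsionMap_torsionMap hψ)
      ⟨⟨P, AddSubgroup.torsionBy.nsmul_iff.2 hP⟩, fun h => hψP (congrArg Subtype.val h)⟩ hg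
  refine ⟨(ZMod.intCast_zmod_eq_zero_iff_dvd m p).1 hm0, ?_, ?_⟩
  · refine Representation.nonempty_equiv_of_scalar (a := fun g => a g) hT hW
      (fun g v => ha g v) (fun g w => ?_)
    exact (hb g w).trans (by rw [← hscal g ((hfix g).1 g.2)])
  · rintro ⟨hp4, hK⟩
    have hainv : ∀ g, a g * a g⁻¹ = 1 := fun g => by
      rw [← map_mul, mul_inv_cancel, map_one]
    have hsqa : ∀ g, ε g = 1 → a g ^ 2 = (modCyclotomicCharacter p g : (ZMod p)ˣ) := by
      intro g hg
      have h1 := hscal g hg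
      have h3 := hainv g
      linear_combination a g * h1 + (modCyclotomicCharacter p g : ZMod p) * h3
    obtain ⟨g, hg⟩ : ∃ g, a g ≠ (modCyclotomicCharacter p g : (ZMod p)ˣ) * a g⁻¹ := by
      by_contra hno
      push Not at hno
      refine hT' (Representation.nonempty_equiv_of_scalar hT hW ha fun g w => ?_)
      rw [hb, ← hno]
    -- g sends the image of δ to ± itself, so g² fixes it.
    have hgε : ε (g * g) = 1 := by
      rw [hεj]
      have h1 : g (j δ) = j δ ∨ g (j δ) = -j δ := by
        rw [← sq_eq_sq_iff_eq_or_eq_neg, ← map_pow, ← map_pow, hδ, map_intCast, map_intCast]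
      change g (g (j δ)) = j δ
      rcases h1 with h1 | h1 <;> simp [h1]
    have h1 := hsqa _ hgε
    rw [map_mul, map_mul, Units.val_mul] at h1
    have h3 := hainv g
    have ha0 : a g ≠ 0 := left_ne_zero_of_mul_eq_one h3
    -- From a(g²)² = χ(g²) one gets a(g)⁴ = χ(g)². The plus sign is excluded by the choice of g, and
    -- the minus sign makes χ(g) a non-square.
    have h4 : (modCyclotomicCharacter p g : ZMod p) = a g ^ 2 ∨
        (modCyclotomicCharacter p g : ZMod p) = -a g ^ 2 := by
      rw [← sq_eq_sq_iff_eq_or_eq_neg]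
      linear_combination -h1
    rcases h4 with h4 | h4
    · refine hg ?_
      rw [h4]
      linear_combination -a g * h3
    · have h5 := quadraticChar_modCyclotomicCharacter p hp4 hK g
      rw [h4, quadraticChar_neg_sq p hp4 ha0] at h5
      norm_num at h5

end

theorem mainTheorem7 {K : Type*} [Field K] [NumberField K]
    {L : Type*} [Field L] [NumberField L] [Algebra.IsQuadraticExtension ℚ L]
    [NumberField.IsTotallyComplex L] (j : L →+* AlgebraicClosure K)
    (O : Subring L) (hO : IsOrderIn O)
    (p : ℕ) [Fact p.Prime] (hp : p ≠ 2)
    (E : WeierstrassCurve K) [E.IsElliptic]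
    (hKL : compositum K j ≠ ⊥) (hCM : E.HasCMOver O (compositum K j))
    (T : Subrepresentation (E.torsionRep p))
    (hT : Module.finrank (ZMod p) T.toSubmodule = 1)
    (hT' : ¬ Nonempty (Representation.Equiv T.toRepresentation (dualTwist T.toRepresentation)))
    (hE : IsNontrivialExtension (E.torsionRep p) T (dualTwist T.toRepresentation)) :
    (p : ℤ) ∣ orderDiscr O ∧
      IsIsomorphicOn (compositum K j).fixingSubgroup T.toRepresentation
        (dualTwist T.toRepresentation) ∧
      ¬ (p % 4 = 3 ∧ IsSquare (-(p : K))) := by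
  obtain ⟨δ, m, hm, hδ, hδQ, hdvd⟩ := exists_sq_eq_int_of_forall_mul_mem
    hO.orderConductor_ne_zero (orderConductor_mul_mem O) (Fact.out : p.Prime) hp
  have h := galois_structure_of_sq_eq_int j O p hp E hKL hCM T hT hT' hE hm hδ hδQ
  exact ⟨hdvd h.1, h.2⟩
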